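/- **Theorem (Time complexity of the TTF algorithm).** Let $G=(V,E)$ be a simple, connected, undirected graph with $n=|V|\ge 2$ nodes, $m=|E|$ edges and diameter $\Delta$, given by adjacency arrays; let $r\in V$, let $P=D^{-1}A$ be the transition matrix of the simple random walk on $G$, and let $P_r$ be $P$ with the row and the column of $r$ removed. The algorithm TTF with root $r$ and $\omega$ samples first computes a breadth-first search tree $\tau_0$ rooted at $r$, its depth-first numbering and the number $2m$, and initializes an array `vol_sum` to zero (preprocessing). Then it repeats $\omega$ times: (i) sample a spanning tree $\tau$ rooted at $r$ by Wilson's algorithm (loop-erased random walks, started at the nodes in a fixed order and stopped when they hit the current tree, which initially is $\{r\}$); (ii) compute $\mathrm{vol}[v]$, the sum of the degrees in $G$ over the subtree $\mathrm{Sub}(\tau,v)$, for all $v$; (iii) run a depth-first search on $\tau$ that, on entering a node $v\ne r$ with parent $p(v)$ in $\tau$, adds $2m-\mathrm{vol}[v]$ to `vol_sum` on $\mathrm{Sub}(\tau_0,v)$ if $p(v)$ is the parent of $v$ in $\tau_0$, subtracts $2m-\mathrm{vol}[v]$ on $\mathrm{Sub}(\tau_0,p(v))$ if $v$ is the parent of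 $p(v)$ in $\tau_0$, then adds $d(v)\cdot$`vol_sum`$[v]$ to the estimate $\tilde\kappa$, recurses to the children of $v$ in $\tau$, and undoes the update. Finally it returns $\tilde\kappa/(2m\omega)$. The array `vol_sum` is kept either in a binary indexed tree (BIT) over the depth-first numbers of $\tau_0$, or naively, by storing each update at the root of the updated subtree and answering a query at $v$ by traversing the path from $v$ to $r$ in $\tau_0$; TTF chooses the naive variant if the height of $\tau_0$ is at most $\log_2 n$, and the BIT otherwise. Running time is counted in the unit-cost random access model, in which drawing a uniformly random neighbour takes one unit of time. There is an absolute constant $C$ such that, for all such $G$, $r$ and all $\omega\ge 0$: 1. $I-P_r$ is invertible, the expected total number of random-walk steps in one run of Wilson's algorithm is exactly $\mathrm{Tr}(I-P_r)^{-1}$, and its expected running time is at most $C\,\mathrm{Tr}(I-P_r)^{-1}$. 2. For every spanning tree $\tau$ of $G$ rooted at $r$, steps (ii) and (iii) take time at most $C\,n\log n$ with the BIT and at most $C\,n\Delta$ with the naive traversal. 3. The preprocessing takes time at most $C\,m$. 4. The expected running time of the sampling loop is at most $C\,\omega\left(\mathrm{Tr}(I-P_r)^{-1}+n\min(\Delta,\log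 n)\right)$, and that of the whole algorithm is at most $C\left(m+\omega\left(\mathrm{Tr}(I-P_r)^{-1}+n\min(\Delta,\log n)\right)\right)$. -/

import Mathlib

open scoped ENNReal

namespace KemenyTTF

/-! ### Cost model

The running time is measured in the unit-cost random access model: reading or writing one array
cell, one integer operation or comparison, and drawing one uniformly random neighbour of a vertex
each take constant time. Every `tick` below stands for a bounded number of such operations.
Arrays are modelled as functions; they are only accessed cell by cell, and creating an array
is charged its length. -/

/-- A deterministic computation: its result together with the number of elementary operations. -/
structure Timed (α : Type) where
  val : α
  time : ℕ

instance : Monad Timed where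
  pure a := ⟨a, 0⟩
  bind c f := ⟨(f c.val).val, c.time + (f c.val).time⟩

/-- Spend `k` elementary operations. -/
def tick (k : ℕ := 1) : Timed Unit := ⟨(), k⟩

/-- The prices of an elementary deterministic operation and of one random draw. -/
structure CostModel where
  basic : ℕ
  draw : ℕ

/-- Running time: everything costs one unit. -/
def timeCost : CostModel := ⟨1, 1⟩

/-- Only random-walk steps are counted. -/
def walkCost : CostModel := ⟨0, 1⟩

/-- A randomized computation, given by what happens when it is run with a cost limit `t`:
the outcome is `some (a, t')` if it returns `a` with `t'` units of the limit left over, and `none`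
if it needs more than `t` units (in particular if it never stops). -/
def Prog (α : Type) : Type := ℕ → PMF (Option (α × ℕ))

noncomputable instance : Monad Prog where
  pure a := fun t => PMF.pure (some (a, t))
  bind p f := fun t => (p t).bind fun
    | none => PMF.pure none
    | some (a, t') => f a t'

/-- The expected cost `E[T] = ∑_{t ≥ 0} Pr[T > t]`; it is infinite whenever the computation fails
to stop with positive probability. -/
noncomputable def expectedCost {α : Type} (p : Prog α) : ℝ≥0∞ := ∑' t : ℕ, p t none

/-- A deterministic computation as part of a randomized one. -/
noncomputable def runTimed {α : Type} (w : CostModel) (c : Timed α) : Prog α := fun t =>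
  if w.basic * c.time ≤ t then PMF.pure (some (c.val, t - w.basic * c.time)) else PMF.pure none

/-! ### Input -/

/-- The input format: the neighbours of every vertex, stored in an array whose length (the degree)
is available in constant time. -/
structure AdjLists {n : ℕ} (G : SimpleGraph (Fin n)) where
  nbrs : Fin n → List (Fin n)
  nodup : ∀ v, (nbrs v).Nodup
  mem_nbrs : ∀ v w, w ∈ nbrs v ↔ G.Adj v w

/-- The degree `d(v)`. -/
def AdjLists.deg {n : ℕ} {G : SimpleGraph (Fin n)} (A : AdjLists G) (v : Fin n) : ℤ :=
  ((A.nbrs v).length : ℤ)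

/-- A rooted tree is stored as its array of parents; the root has parent `none`. -/
abbrev Parents (n : ℕ) : Type := Fin n → Option (Fin n)

/-- `par` is a spanning tree of `G` with all edges directed towards the root `r`. -/
def IsSpanningTree {n : ℕ} (G : SimpleGraph (Fin n)) (r : Fin n) (par : Parents n) : Prop :=
  par r = none ∧ (∀ v, v ≠ r → ∃ p, par v = some p ∧ G.Adj v p) ∧
    ∀ v, ∃ k : ℕ, (fun o : Option (Fin n) => o.bind par)^[k] (some v) = some r

/-- The transition matrix `P = D⁻¹ A` of the simple random walk. -/
noncomputable def transitionMatrix {n : ℕ} (G : SimpleGraph (Fin n)) [DecidableRel G.Adj] :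
    Matrix (Fin n) (Fin n) ℝ :=
  (Matrix.diagonal fun v => (G.degree v : ℝ))⁻¹ * G.adjMatrix ℝ

/-- `I - P_r`, where `P_r` is `P` with the row and the column of `r` removed. -/
noncomputable def laplacianMinor {n : ℕ} (G : SimpleGraph (Fin n)) [DecidableRel G.Adj]
    (r : Fin n) : Matrix {v : Fin n // v ≠ r} {v : Fin n // v ≠ r} ℝ :=
  1 - (transitionMatrix G).submatrix Subtype.val Subtype.val

/-! ### Wilson's algorithm

In the recursions below a first argument of type `ℕ` that is started at `n` bounds the length of a
path followed in a tree on `n` vertices (or the depth of a recursion along such a path); paths in a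
tree have at most `n` vertices, so the bound is never what stops the recursion. -/

/-- Draw a uniformly random neighbour of `u`. (The second case, of an isolated vertex, does not
occur in a connected graph with at least two vertices.) -/
noncomputable def randomNeighbor {n : ℕ} {G : SimpleGraph (Fin n)} (w : CostModel)
    (A : AdjLists G) (u : Fin n) : Prog (Fin n) := fun t =>
  if w.draw ≤ t then
    if h : (A.nbrs u).toFinset.Nonempty then
      (PMF.uniformOfFinset (A.nbrs u).toFinset h).map fun x => some (x, t - w.draw)
    else PMF.pure (some (u, t - w.draw))
  else PMF.pure none

/-- `while u ∉ tree do { next[u] ← random neighbour of u; u ← next[u] }`, with at most `f - 1` rounds. -/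
noncomputable def walkRounds {n : ℕ} {G : SimpleGraph (Fin n)} (w : CostModel) (A : AdjLists G)
    (inTree : Fin n → Bool) : ℕ → Fin n → Parents n → Prog (Parents n)
  | 0, _, _ => fun _ => PMF.pure none
  | f + 1, u, next => do
      runTimed w (tick)
      if inTree u then
        return next
      else
        let x ← randomNeighbor w A u
        walkRounds w A inTree f x (Function.update next u (some x))

/-- The loop `while u ∉ tree do { next[u] ← random neighbour of u; u ← next[u] }`. Every round costs
at least one unit (as long as a random draw does), so that with cost limit `t` at most `t` rounds
can be completed, and allowing for `t + 1` of them is no restriction. -/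
noncomputable def walk {n : ℕ} {G : SimpleGraph (Fin n)} (w : CostModel) (A : AdjLists G)
    (inTree : Fin n → Bool) (u : Fin n) (next : Parents n) : Prog (Parents n) := fun t =>
  walkRounds w A inTree (t + 2) u next t

/-- `while u ∉ tree do { add u to the tree; u ← next[u] }`: add the loop-erased walk. -/
def addPath {n : ℕ} (next : Parents n) : ℕ → Fin n → (Fin n → Bool) → Timed (Fin n → Bool)
  | 0, _, inTree => pure inTree
  | f + 1, u, inTree => do
      tick
      if inTree u then
        return inTree
      else
        match next u with
        | none => return inTree
        | some x => addPath next f x (Function.update inTree u true)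

/-- Wilson's algorithm: starting from the tree `{r}`, for one vertex after the other a random walk
is run until it hits the current tree, and its loop erasure (which is what the last exits
`next` record) is added to the tree. -/
noncomputable def wilson {n : ℕ} {G : SimpleGraph (Fin n)} (w : CostModel) (A : AdjLists G)
    (r : Fin n) : Prog (Parents n) := do
  runTimed w (tick (2 * n))
  let s ← (List.finRange n).foldlM
    (fun (s : (Fin n → Bool) × Parents n) v => do
      let next ← walk w A s.1 v s.2
      let inTree ← runTimed w (addPath next n v s.1)
      return (inTree, next))
    (Function.update (fun _ => false) r true, fun _ => none)
  return s.2

/-! ### Breadth-first search, children, depth-first numbers, subtree volumes -/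

/-- State of the breadth-first search; `fresh` collects the vertices of the next level. -/
structure BFSState (n : ℕ) where
  visited : Fin n → Bool
  par : Parents n
  fresh : List (Fin n)

/-- Scan the neighbours of `v`; the ones not seen before become children of `v`. -/
def bfsScan {n : ℕ} {G : SimpleGraph (Fin n)} (A : AdjLists G) (s : BFSState n) (v : Fin n) :
    Timed (BFSState n) := do
  tick
  (A.nbrs v).foldlM (fun (s : BFSState n) x => do
    tick
    if s.visited x then
      return s
    else
      return ⟨Function.update s.visited x true, Function.update s.par x (some v), x :: s.fresh⟩) s

/-- Process level after level, starting from the level `s.fresh`, until a level is empty (there are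
at most `n` nonempty levels); `h` counts the levels. Returns the tree and its height. -/
def bfsLevels {n : ℕ} {G : SimpleGraph (Fin n)} (A : AdjLists G) :
    ℕ → ℕ → BFSState n → Timed (Parents n × ℕ)
  | 0, h, s => pure (s.par, h)
  | f + 1, h, s => do
      tick
      let s' ← s.fresh.foldlM (bfsScan A) { s with fresh := [] }
      if s'.fresh.isEmpty then
        return (s'.par, h)
      else
        bfsLevels A f (h + 1) s'

/-- The breadth-first search tree with root `r`, and its height. -/
def bfs {n : ℕ} {G : SimpleGraph (Fin n)} (A : AdjLists G) (r : Fin n) :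
    Timed (Parents n × ℕ) := do
  tick (2 * n)
  bfsLevels A n 0 ⟨Function.update (fun _ => false) r true, fun _ => none, [r]⟩

/-- The lists of children in a tree. -/
def childLists {n : ℕ} (par : Parents n) : Timed (Fin n → List (Fin n)) := do
  tick n
  (List.finRange n).foldlM (fun (ch : Fin n → List (Fin n)) v => do
    tick
    match par v with
    | none => return ch
    | some p => return Function.update ch p (v :: ch p)) fun _ => []

/-- Depth-first numbering: current clock, entry numbers and exit numbers. The vertices are numbered
from `1`, and the subtree of `v` consists of the vertices numbered `dfsIn v, …, dfsOut v`. -/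
structure DFN (n : ℕ) where
  clock : ℕ
  dfsIn : Fin n → ℕ
  dfsOut : Fin n → ℕ

/-- Number the subtree of `v`. -/
def dfnFrom {n : ℕ} (ch : Fin n → List (Fin n)) : ℕ → Fin n → DFN n → Timed (DFN n)
  | 0, _, s => pure s
  | f + 1, v, s => do
      tick
      let s' ← (ch v).foldlM (fun s c => dfnFrom ch f c s)
        ⟨s.clock + 1, Function.update s.dfsIn v (s.clock + 1), s.dfsOut⟩
      tick
      return { s' with dfsOut := Function.update s'.dfsOut v s'.clock }

/-- Fill in `vol[u] = ∑_{x ∈ Sub(τ, u)} d(x)` for all `u` in the subtree of `v`. -/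
def volumesFrom {n : ℕ} {G : SimpleGraph (Fin n)} (A : AdjLists G) (ch : Fin n → List (Fin n)) :
    ℕ → Fin n → (Fin n → ℤ) → Timed (Fin n → ℤ)
  | 0, _, vol => pure vol
  | f + 1, v, vol => do
      tick
      (ch v).foldlM (fun (vol : Fin n → ℤ) c => do
        let vol' ← volumesFrom A ch f c vol
        tick
        return Function.update vol' v (vol' v + vol' c)) (Function.update vol v (A.deg v))

/-! ### The structure `vol_sum` -/

/-- The lowest set bit of `i`. -/
def lowbit (i : ℕ) : ℕ := i - (i &&& (i - 1))

theorem and_pred_lt {i : ℕ} (h : 0 < i) : i &&& (i - 1) < i :=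
  lt_of_le_of_lt Nat.and_le_right (Nat.sub_lt h Nat.one_pos)

theorem lowbit_pos {i : ℕ} (h : 0 < i) : 0 < lowbit i :=
  Nat.sub_pos_of_lt (and_pred_lt h)

/-- Binary indexed tree with cells `1, …, n`: add `x` to all prefix sums of length at least `i`. -/
def bitAdd (n i : ℕ) (x : ℤ) (a : ℕ → ℤ) : Timed (ℕ → ℤ) :=
  if h : 0 < i ∧ i ≤ n then do
    tick
    bitAdd n (i + lowbit i) x (Function.update a i (a i + x))
  else do
    tick
    return a
termination_by n + 1 - i
decreasing_by
  have := lowbit_pos h.1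
  omega

/-- Binary indexed tree: the prefix sum of length `i`. -/
def bitSum (a : ℕ → ℤ) (i : ℕ) : Timed ℤ :=
  if h : 0 < i then do
    tick
    let s ← bitSum a (i &&& (i - 1))
    return a i + s
  else do
    tick
    return 0
termination_by i
decreasing_by exact and_pred_lt h

/-- The sum of the cells of all vertices on the path from `v` to the root of `par`. -/
def pathSum {n : ℕ} (par : Parents n) (a : ℕ → ℤ) : ℕ → Fin n → Timed ℤ
  | 0, _ => pure 0
  | f + 1, v => do
      tick
      match par v with
      | none => return a v
      | some p => do
          let s ← pathSum par a f p
          return a v + s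

/-- The two implementations of `vol_sum`: a binary indexed tree over the depth-first numbers of
`τ₀` (logarithmic update and query), or naively one cell per vertex and, for a query at `v`, a
traversal of the path from `v` to the root in `τ₀` (constant update, query linear in the path). -/
inductive Mode where
  | bit
  | path

/-- Everything that is computed before sampling starts: the breadth-first search tree `τ₀`, its
depth-first numbers, the number `2m`, the implementation of `vol_sum`, and the initial `vol_sum`. -/
structure Prep (n : ℕ) where
  par₀ : Parents n
  dfn : DFN n
  twoM : ℤ
  mode : Mode
  store : ℕ → ℤ

/-- Add `x` to `vol_sum[u]` for all `u` in the subtree of `v` in `τ₀`. -/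
def volSumAdd {n : ℕ} (D : Prep n) (mode : Mode) (v : Fin n) (x : ℤ) (a : ℕ → ℤ) :
    Timed (ℕ → ℤ) :=
  match mode with
  | .bit => do
      let a' ← bitAdd n (D.dfn.dfsIn v) x a
      bitAdd n (D.dfn.dfsOut v + 1) (-x) a'
  | .path => do
      tick
      return Function.update a v (a v + x)

/-- The value of `vol_sum[v]`. -/
def volSumQuery {n : ℕ} (D : Prep n) (mode : Mode) (v : Fin n) (a : ℕ → ℤ) : Timed ℤ :=
  match mode with
  | .bit => bitSum a (D.dfn.dfsIn v)
  | .path => pathSum D.par₀ a n v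

/-! ### The algorithm -/

/-- Preprocessing. The naive implementation of `vol_sum` is chosen if the height of the
breadth-first search tree is at most `log₂ n`. -/
def preprocess {n : ℕ} {G : SimpleGraph (Fin n)} (A : AdjLists G) (r : Fin n) :
    Timed (Prep n) := do
  let b ← bfs A r
  let ch ← childLists b.1
  tick (2 * n)
  let dfn ← dfnFrom ch n r ⟨0, fun _ => 0, fun _ => 0⟩
  let twoM ← (List.finRange n).foldlM (fun (s : ℤ) v => do tick; return s + A.deg v) 0
  tick (Nat.log 2 n + 1)
  let mode := if b.2 ≤ Nat.log 2 n then Mode.path else Mode.bit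
  tick (n + 1)
  return ⟨b.1, dfn, twoM, mode, fun _ => 0⟩

/-- The update of `vol_sum` on entering `v`: if the edge from `v` to its parent `p` in `τ` is also an
edge of `τ₀` directed in the same way, then `2m - vol[v]` is added on the subtree of `v` in `τ₀`; if
the reverse edge belongs to `τ₀`, then `2m - vol[v]` is subtracted on the subtree of `p` in `τ₀`. -/
def shift {n : ℕ} (D : Prep n) (par : Parents n) (vol : Fin n → ℤ) (v : Fin n) :
    Option (Fin n × ℤ) :=
  match par v with
  | none => none
  | some p =>
      if D.par₀ v = some p then some (v, D.twoM - vol v)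
      else if D.par₀ p = some v then some (p, vol v - D.twoM)
      else none

/-- The recursive procedure `DFS(v, τ, τ₀)`; the state consists of the estimator accumulated so far
and of `vol_sum`. -/
def dfs {n : ℕ} {G : SimpleGraph (Fin n)} (A : AdjLists G) (D : Prep n) (mode : Mode)
    (par : Parents n) (ch : Fin n → List (Fin n)) (vol : Fin n → ℤ) :
    ℕ → Fin n → ℤ × (ℕ → ℤ) → Timed (ℤ × (ℕ → ℤ))
  | 0, _, s => pure s
  | f + 1, v, s => do
      tick
      let a ← match shift D par vol v with
        | none => pure s.2
        | some (u, x) => volSumAdd D mode u x s.2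
      let y ← volSumQuery D mode v a
      let s' ← (ch v).foldlM (fun s c => dfs A D mode par ch vol f c s) (s.1 + A.deg v * y, a)
      let a' ← match shift D par vol v with
        | none => pure s'.2
        | some (u, x) => volSumAdd D mode u (-x) s'.2
      return (s'.1, a')

/-- What is done with one sampled tree: subtree volumes and depth-first search. -/
def processSample {n : ℕ} {G : SimpleGraph (Fin n)} (A : AdjLists G) (r : Fin n) (D : Prep n)
    (mode : Mode) (par : Parents n) (s : ℤ × (ℕ → ℤ)) : Timed (ℤ × (ℕ → ℤ)) := do
  let ch ← childLists par
  tick n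
  let vol ← volumesFrom A ch n r fun _ => 0
  dfs A D mode par ch vol n r s

/-- The sampling loop with `k` samples. -/
noncomputable def samplingLoop {n : ℕ} {G : SimpleGraph (Fin n)} (A : AdjLists G) (r : Fin n)
    (D : Prep n) : ℕ → ℤ × (ℕ → ℤ) → Prog (ℤ × (ℕ → ℤ))
  | 0, s => pure s
  | k + 1, s => do
      runTimed timeCost (tick)
      let par ← wilson timeCost A r
      let s' ← runTimed timeCost (processSample A r D D.mode par s)
      samplingLoop A r D k s'

/-- The algorithm TTF with root `r` and `ω` samples. -/
noncomputable def ttf {n : ℕ} {G : SimpleGraph (Fin n)} (A : AdjLists G) (r : Fin n) (ω : ℕ) :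
    Prog ℚ := do
  let D ← runTimed timeCost (preprocess A r)
  let s ← samplingLoop A r D ω (0, D.store)
  runTimed timeCost (tick)
  return (s.1 : ℚ) / ((D.twoM : ℚ) * ω)

end KemenyTTF

/-!
Let `g B x` be the expected number of visits to `x` of the random walk that starts at `x` and is
stopped at `B`; then `Tr (I - P_r)⁻¹ = ∑ x ≠ r, g {r} x`. Suppose that in a run of Wilson's
algorithm the tree is `S` and the current walk is at `u`, and consider

  `Φ = E (hitting time of S) + E (∑ x, g (S ∪ final loop-erased path) x)`,

with the sum over the vertices `x` outside the enlarged tree. The first term decreases by `1` in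
the mean with every step of the walk. The second one is preserved in the mean, by the symmetry
`g B x * g (B ∪ {x}) u = g B u * g (B ∪ {u}) x`, and neither term is changed by erasing a loop. At
the start `v` of a walk the second term is `∑ x ∉ S, g S x` minus the expected numbers of visits of
the walk from `v`, which sum to the hitting time, so that `Φ = ∑ x ∉ S, g S x`. When the walk hits
`S`, what remains of `Φ` is the same expression for the enlarged tree. Hence `Φ` solves
the first-step equations of the expected number of remaining steps. By truncation `Φ` bounds this
number, which is therefore finite, and a minimum principle for functions of the position and the
loop-erased path shows that the two are equal.

The other running times are obtained by counting. Every step of a BIT query clears the last nonzero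
bit of the index and every step of an update raises its 2-adic valuation, so both take `O(log n)`
steps; a path in the breadth-first search tree has at most `Δ` edges. The `O(n)` overhead of
Wilson's algorithm is absorbed by the trace, because `g {r} x ≥ 1` for all `x ≠ r`.
-/

namespace KemenyTTF

/-! ### Deterministic computations -/

section Timed

variable {α β σ : Type}

@[simp] theorem Timed.pure_val (a : α) : (pure a : Timed α).val = a := rfl

@[simp] theorem Timed.pure_time (a : α) : (pure a : Timed α).time = 0 := rfl

@[simp] theorem Timed.bind_val (c : Timed α) (f : α → Timed β) :
    (c >>= f).val = (f c.val).val := rfl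

@[simp] theorem Timed.bind_time (c : Timed α) (f : α → Timed β) :
    (c >>= f).time = c.time + (f c.val).time := rfl

@[simp] theorem tick_time (k : ℕ) : (tick k).time = k := rfl

theorem Timed.foldlM_val (f : σ → β → Timed σ) (l : List β) (s : σ) :
    (l.foldlM f s).val = l.foldl (fun s b => (f s b).val) s := by
  induction l generalizing s with
  | nil => rfl
  | cons b l ih => simp [List.foldlM_cons, ih]

theorem Timed.foldlM_time_le {f : σ → β → Timed σ} {g : β → ℕ}
    (h : ∀ s b, (f s b).time ≤ g b) (l : List β) (s : σ) :
    (l.foldlM f s).time ≤ (l.map g).sum := by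
  induction l generalizing s with
  | nil => simp
  | cons b l ih =>
    simp only [List.foldlM_cons, Timed.bind_time, List.map_cons, List.sum_cons]
    exact add_le_add (h s b) (ih _)

theorem foldl_invariant {f : σ → β → σ} {I : σ → Prop} {l : List β} {s : σ}
    (hs : I s) (h : ∀ s, ∀ b ∈ l, I s → I (f s b)) : I (l.foldl f s) := by
  induction l generalizing s with
  | nil => exact hs
  | cons b l ih =>
    exact ih (h s b (by simp) hs) fun s b hb => h s b (by simp [hb])

end Timed

/-! ### Rooted forests as parent arrays -/

section Forest

variable {V : Type*}

/-- The vertex reached from `v` by following `k` parent pointers; `none` if the path from `v` to its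
root is shorter than that. -/
def ancestor (par : V → Option V) (k : ℕ) (v : V) : Option V :=
  (fun o : Option V => o.bind par)^[k] (some v)

variable {par : V → Option V}

@[simp] theorem ancestor_zero (v : V) : ancestor par 0 v = some v := rfl

theorem ancestor_succ (k : ℕ) (v : V) :
    ancestor par (k + 1) v = (ancestor par k v).bind par :=
  Function.iterate_succ_apply' _ _ _

theorem ancestor_add (k l : ℕ) (v : V) :
    ancestor par (k + l) v = (ancestor par k v).bind (ancestor par l) := by
  induction l with
  | zero => exact (Option.bind_fun_some _).symm
  | succ l ih =>
    rw [← add_assoc, ancestor_succ, ih, Option.bind_assoc]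
    simp only [ancestor_succ]

theorem ancestor_succ_eq_bind (k : ℕ) (v : V) :
    ancestor par (k + 1) v = (par v).bind (ancestor par k) := by
  rw [add_comm, ancestor_add, ancestor_succ, ancestor_zero, Option.bind_some]

theorem ancestor_eq_none_of_lt {r : V} (hr : par r = none) {k l : ℕ} {v : V}
    (hk : ancestor par k v = some r) (hkl : k < l) : ancestor par l v = none := by
  obtain ⟨j, rfl⟩ := Nat.exists_eq_add_of_lt hkl
  rw [add_assoc, ancestor_add, hk, Option.bind_some, ancestor_succ_eq_bind, hr,
    Option.bind_none]

theorem depth_unique {r : V} (hr : par r = none) {k l : ℕ} {v : V}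
    (hk : ancestor par k v = some r) (hl : ancestor par l v = some r) : k = l := by
  rcases lt_trichotomy k l with hkl | hkl | hkl
  · simp [ancestor_eq_none_of_lt hr hk hkl] at hl
  · exact hkl
  · simp [ancestor_eq_none_of_lt hr hl hkl] at hk

theorem ancestor_eq_none_of_decreasing {δ : V → ℕ} (hδ : ∀ v p, par v = some p → δ p < δ v)
    {k : ℕ} {v : V} (hv : δ v < k) : ancestor par k v = none := by
  induction k generalizing v with
  | zero => simp at hv
  | succ k ih =>
    rw [ancestor_succ_eq_bind]
    rcases hp : par v with _ | p
    · rfl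
    · exact ih (by have := hδ v p hp; omega)

/-- The lists `ch` enumerate, without repetition, the children in the forest `par`. -/
structure EnumeratesChildren (par : V → Option V) (ch : V → List V) : Prop where
  nodup : ∀ v, (ch v).Nodup
  mem_iff : ∀ v c, c ∈ ch v ↔ par c = some v

/-- The sum of `g` over the vertices met by a depth-first traversal from `v`, cut off at recursion
depth `f`. -/
def treeSum (ch : V → List V) (g : V → ℕ) : ℕ → V → ℕ
  | 0, _ => 0
  | f + 1, v => g v + ((ch v).map (treeSum ch g f)).sum

variable [Fintype V] {ch : V → List V}

theorem treeSum_eq_sum_ancestor [DecidableEq V] (hch : EnumeratesChildren par ch) (g : V → ℕ)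
    (f : ℕ) (v : V) :
    treeSum ch g f v =
      ∑ x, ∑ k ∈ Finset.range f, if ancestor par k x = some v then g x else 0 := by
  rw [Finset.sum_comm]
  induction f generalizing v with
  | zero => simp [treeSum]
  | succ f ih =>
    rw [treeSum, Finset.sum_range_succ', add_comm]
    congr 1
    · rw [← List.sum_toFinset _ (hch.nodup v), Finset.sum_congr rfl fun c _ => ih c,
        Finset.sum_comm]
      refine Finset.sum_congr rfl fun k _ => ?_
      rw [Finset.sum_comm]
      refine Finset.sum_congr rfl fun x _ => ?_
      rw [ancestor_succ]
      rcases ancestor par k x with _ | c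
      · simp
      · simp [hch.mem_iff]
    · simp

theorem treeSum_root_le (hch : EnumeratesChildren par ch) {r : V} (hr : par r = none)
    (g : V → ℕ) (f : ℕ) : treeSum ch g f r ≤ ∑ x, g x := by
  classical
  rw [treeSum_eq_sum_ancestor hch]
  refine Finset.sum_le_sum fun x _ => ?_
  rw [← Finset.sum_filter, Finset.sum_const, smul_eq_mul]
  refine mul_le_of_le_one_left (Nat.zero_le _) (Finset.card_le_one.2 fun k hk l hl => ?_)
  exact depth_unique hr (Finset.mem_filter.1 hk).2 (Finset.mem_filter.1 hl).2

theorem sum_length_children_le (hch : EnumeratesChildren par ch) :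
    ∑ v, (ch v).length ≤ Fintype.card V := by
  classical
  have length_eq (v : V) : (ch v).length = ∑ c, if par c = some v then 1 else 0 := by
    rw [← List.toFinset_card_of_nodup (hch.nodup v), Finset.sum_boole, Nat.cast_id]
    congr 1
    ext c
    simp [hch.mem_iff]
  calc ∑ v, (ch v).length = ∑ c, ∑ v, if par c = some v then 1 else 0 := by
        simp only [length_eq]
        exact Finset.sum_comm
    _ ≤ ∑ _ : V, 1 := Finset.sum_le_sum fun c _ => by rcases par c with _ | p <;> simp
    _ = Fintype.card V := by simp

end Forest

section Children

variable {n : ℕ} (par : Parents n)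

theorem childLists_val (p : Fin n) :
    (childLists par).val p = ((List.finRange n).filter fun v => par v = some p).reverse := by
  have foldlM_val_append (l : List (Fin n)) (ch : Fin n → List (Fin n)) :
      (l.foldlM (fun (ch : Fin n → List (Fin n)) v => do
        tick
        match par v with
        | none => return ch
        | some p => return Function.update ch p (v :: ch p)) ch : Timed _).val p =
      (l.filter fun v => par v = some p).reverse ++ ch p := by
    induction l generalizing ch with
    | nil => simp
    | cons v l ih =>
      rw [List.foldlM_cons, Timed.bind_val, ih]
      rcases hv : par v with _ | q
      · simp [hv]
      · by_cases hq : q = p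
        · subst hq; simp [hv]
        · simp [hv, hq, Function.update_of_ne (Ne.symm hq)]
  exact (foldlM_val_append _ _).trans (by simp)

theorem enumeratesChildren_childLists : EnumeratesChildren par (childLists par).val where
  nodup p := by
    rw [childLists_val, List.nodup_reverse]
    exact (List.nodup_finRange n).filter _
  mem_iff p c := by simp [childLists_val]

theorem childLists_time_le : (childLists par).time ≤ 2 * n := by
  calc (childLists par).time = n + _ := rfl
    _ ≤ n + ((List.finRange n).map fun _ => 1).sum := by
      refine Nat.add_le_add_left (Timed.foldlM_time_le (fun s b => ?_) _ _) n
      rcases par b with _ | q <;> simp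
    _ = 2 * n := by simp [two_mul]

end Children

/-! ### Depth-first traversals -/

section Traversals

variable {n : ℕ} (ch : Fin n → List (Fin n))

theorem volumesFrom_time_le {G : SimpleGraph (Fin n)} (A : AdjLists G) (f : ℕ) (v : Fin n)
    (vol : Fin n → ℤ) :
    (volumesFrom A ch f v vol).time ≤ treeSum ch (fun v => 1 + (ch v).length) f v := by
  induction f generalizing v vol with
  | zero => simp [volumesFrom, treeSum]
  | succ f ih =>
    simp only [volumesFrom, treeSum, Timed.bind_time, tick_time, add_assoc]
    gcongr
    refine (Timed.foldlM_time_le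
      (g := fun c => treeSum ch (fun v => 1 + (ch v).length) f c + 1) (fun s c => ?_) _ _).trans ?_
    · simp only [Timed.bind_time, tick_time, Timed.pure_time]
      exact Nat.add_le_add_right (ih c s) 1
    · rw [List.sum_map_add, add_comm]
      simp

theorem dfnFrom_time_le (f : ℕ) (v : Fin n) (s : DFN n) :
    (dfnFrom ch f v s).time ≤ treeSum ch (fun _ => 2) f v := by
  induction f generalizing v s with
  | zero => simp [dfnFrom, treeSum]
  | succ f ih =>
    simp only [dfnFrom, treeSum, Timed.bind_time, tick_time, Timed.pure_time]
    have := Timed.foldlM_time_le (fun s c => ih c s) (ch v)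
      ⟨s.clock + 1, Function.update s.dfsIn v (s.clock + 1), s.dfsOut⟩
    omega

theorem dfnFrom_clock (f : ℕ) (v : Fin n) (s : DFN n) :
    (dfnFrom ch f v s).val.clock = s.clock + treeSum ch (fun _ => 1) f v := by
  induction f generalizing v s with
  | zero => simp [dfnFrom, treeSum]
  | succ f ih =>
    have foldl_clock (l : List (Fin n)) (s : DFN n) :
        (l.foldl (fun s c => (dfnFrom ch f c s).val) s).clock =
          s.clock + (l.map (treeSum ch (fun _ => 1) f)).sum := by
      induction l generalizing s with
      | nil => simp
      | cons c l ihl => simp [ihl, ih, add_assoc]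
    simp only [dfnFrom, treeSum, Timed.bind_val, Timed.pure_val, Timed.foldlM_val, foldl_clock,
      add_assoc]

theorem dfnFrom_dfsIn_le_clock (f : ℕ) (v : Fin n) {s : DFN n} (hs : ∀ x, s.dfsIn x ≤ s.clock)
    (x : Fin n) : (dfnFrom ch f v s).val.dfsIn x ≤ (dfnFrom ch f v s).val.clock := by
  induction f generalizing v s x with
  | zero => exact hs x
  | succ f ih =>
    simp only [dfnFrom, Timed.bind_val, Timed.pure_val, Timed.foldlM_val]
    refine foldl_invariant (I := fun s : DFN n => ∀ x, s.dfsIn x ≤ s.clock) ?_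
      (fun s c _ h x => ih c h x) x
    intro y
    by_cases hy : y = v
    · subst hy; simp
    · simp only [Function.update_of_ne hy]
      exact (hs y).trans (Nat.le_succ _)

end Traversals

/-! ### Binary indexed trees -/

theorem and_pred_two_mul (a : ℕ) : (2 * a) &&& (2 * a - 1) = 2 * (a &&& (a - 1)) := by
  rcases a with _ | a
  · simp
  · apply Nat.eq_of_testBit_eq
    intro i
    rw [show 2 * (a + 1) - 1 = 2 * a + 1 by omega]
    rcases i with _ | i
    · simp
    · simp [Nat.testBit_succ, Nat.and_div_two, show (2 * a + 1) / 2 = a by omega]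

theorem two_dvd_and_pred (i : ℕ) : 2 ∣ i &&& (i - 1) := by
  have := Nat.and_mod_two_eq_one (a := i) (b := i - 1)
  omega

theorem two_pow_succ_dvd_and_pred {k i : ℕ} (h : 2 ^ k ∣ i) : 2 ^ (k + 1) ∣ i &&& (i - 1) := by
  induction k generalizing i with
  | zero => simpa using two_dvd_and_pred i
  | succ k ih =>
    obtain ⟨b, rfl⟩ := h
    rw [pow_succ' 2 k, mul_assoc, and_pred_two_mul, pow_succ' 2 (k + 1)]
    exact Nat.mul_dvd_mul_left 2 (ih (Dvd.intro _ rfl))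

theorem two_pow_succ_dvd_add_lowbit {k i : ℕ} (h : 2 ^ k ∣ i) : 2 ^ (k + 1) ∣ i + lowbit i := by
  have add_lowbit : i + lowbit i = i * 2 - (i &&& (i - 1)) := by
    have : i &&& (i - 1) ≤ i := Nat.and_le_left
    rw [lowbit]
    omega
  rw [add_lowbit]
  exact Nat.dvd_sub (pow_succ 2 k ▸ Nat.mul_dvd_mul_right h 2) (two_pow_succ_dvd_and_pred h)

theorem bitAdd_time_le_of_dvd {n j k i : ℕ} (hj : n < 2 ^ (k + j)) (h : 2 ^ k ∣ i)
    (x : ℤ) (a : ℕ → ℤ) : (bitAdd n i x a).time ≤ j + 1 := by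
  induction j generalizing k i a with
  | zero =>
    rw [bitAdd, dif_neg fun hi => (Nat.le_of_dvd hi.1 h).not_gt (hi.2.trans_lt hj)]
    simp
  | succ j ih =>
    rw [bitAdd]
    split_ifs with hi
    · simp only [Timed.bind_time, tick_time]
      have := ih (by rwa [add_right_comm]) (two_pow_succ_dvd_add_lowbit h)
        (Function.update a i (a i + x))
      omega
    · simp

theorem bitAdd_time_le (n i : ℕ) (x : ℤ) (a : ℕ → ℤ) :
    (bitAdd n i x a).time ≤ Nat.log 2 n + 2 :=
  bitAdd_time_le_of_dvd (k := 0) (by simpa using Nat.lt_pow_succ_log_self one_lt_two n)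
    (one_dvd i) x a

theorem bitSum_time_le_of_dvd {j k i : ℕ} (hj : i < 2 ^ (k + j)) (h : 2 ^ k ∣ i) (a : ℕ → ℤ) :
    (bitSum a i).time ≤ j + 1 := by
  induction j generalizing k i with
  | zero =>
    rw [bitSum, dif_neg (Nat.eq_zero_of_dvd_of_lt h hj).not_gt]
    simp
  | succ j ih =>
    rw [bitSum]
    split_ifs with hi
    · simp only [Timed.bind_time, tick_time, Timed.pure_time]
      have := ih (by rw [add_right_comm]; exact (and_pred_lt hi).trans hj)
        (two_pow_succ_dvd_and_pred h)
      omega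
    · simp

theorem bitSum_time_le (a : ℕ → ℤ) (i : ℕ) : (bitSum a i).time ≤ Nat.log 2 i + 2 :=
  bitSum_time_le_of_dvd (k := 0) (by simpa using Nat.lt_pow_succ_log_self one_lt_two i)
    (one_dvd i) a

/-! ### Processing one sampled tree -/

theorem pathSum_time_le {n : ℕ} {par : Parents n} {d : ℕ} {v : Fin n}
    (h : ancestor par d v = none) (a : ℕ → ℤ) (f : ℕ) : (pathSum par a f v).time ≤ d := by
  induction f generalizing d v with
  | zero => simp [pathSum]
  | succ f ih =>
    rcases d with _ | d
    · simp at h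
    · rw [ancestor_succ_eq_bind] at h
      simp only [pathSum, Timed.bind_time, tick_time]
      rcases hp : par v with _ | p
      · simp
      · rw [hp, Option.bind_some] at h
        have := ih h
        simp only [Timed.bind_time, Timed.pure_time]
        omega

section ProcessSample

variable {n : ℕ} {G : SimpleGraph (Fin n)} (A : AdjLists G) {D : Prep n} {mode : Mode} {U Q : ℕ}

theorem dfs_time_le (hU : ∀ u x a, (volSumAdd D mode u x a).time ≤ U)
    (hQ : ∀ v a, (volSumQuery D mode v a).time ≤ Q) (par : Parents n)
    (ch : Fin n → List (Fin n)) (vol : Fin n → ℤ) (f : ℕ) (v : Fin n) (s : ℤ × (ℕ → ℤ)) :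
    (dfs A D mode par ch vol f v s).time ≤ treeSum ch (fun _ => 1 + 2 * U + Q) f v := by
  induction f generalizing v s with
  | zero => simp [dfs, treeSum]
  | succ f ih =>
    have recursion_le := Timed.foldlM_time_le (fun s c => ih c s) (ch v)
    simp only [dfs, treeSum, Timed.bind_time, tick_time]
    generalize shift D par vol v = o
    rcases o with _ | ⟨u, x⟩
    · simp only [Timed.bind_time, Timed.pure_time]
      refine le_trans (Nat.add_le_add_left (Nat.add_le_add_left (Nat.add_le_add (hQ _ _)
        (Nat.add_le_add_right (recursion_le _) _)) _) _) (by omega)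
    · simp only [Timed.bind_time, Timed.pure_time]
      refine le_trans (Nat.add_le_add_left (Nat.add_le_add (hU _ _ _) (Nat.add_le_add (hQ _ _)
        (Nat.add_le_add (recursion_le _) (Nat.add_le_add_right (hU _ _ _) _)))) _) (by omega)

theorem processSample_time_le_of_volSum (hU : ∀ u x a, (volSumAdd D mode u x a).time ≤ U)
    (hQ : ∀ v a, (volSumQuery D mode v a).time ≤ Q) {r : Fin n} {par : Parents n}
    (hr : par r = none) (s : ℤ × (ℕ → ℤ)) :
    (processSample A r D mode par s).time ≤ n * (6 + 2 * U + Q) := by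
  have hch := enumeratesChildren_childLists par
  have volumes_le : (volumesFrom A (childLists par).val n r fun _ => 0).time ≤ n + n :=
    calc _ ≤ ∑ v, (1 + ((childLists par).val v).length) :=
          (volumesFrom_time_le _ A n r _).trans (treeSum_root_le hch hr _ n)
      _ ≤ n + n := by
          rw [Finset.sum_add_distrib]
          simpa using sum_length_children_le hch
  have dfs_le (vol : Fin n → ℤ) :
      (dfs A D mode par (childLists par).val vol n r s).time ≤ n * (1 + 2 * U + Q) := by
    simpa using (dfs_time_le A hU hQ par _ vol n r s).trans (treeSum_root_le hch hr _ n)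
  calc (processSample A r D mode par s).time
      ≤ 2 * n + (n + ((n + n) + n * (1 + 2 * U + Q))) := by
        simp only [processSample, Timed.bind_time, tick_time]
        gcongr
        exacts [childLists_time_le par, dfs_le _]
    _ = n * (6 + 2 * U + Q) := by ring

end ProcessSample

/-! ### Breadth-first search -/

section GraphDistance

variable {V : Type*} {G : SimpleGraph V}

theorem dist_le_succ_of_adj (hG : G.Connected) {r v x : V} (h : G.Adj v x) :
    G.dist r x ≤ G.dist r v + 1 :=
  SimpleGraph.dist_eq_one_iff_adj.2 h ▸ hG.dist_triangle

theorem exists_adj_dist_eq (hG : G.Connected) {r x : V} {h : ℕ} (hx : G.dist r x = h + 1) :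
    ∃ v, G.Adj v x ∧ G.dist r v = h := by
  obtain ⟨p, hp⟩ := hG.exists_walk_length_eq_dist x r
  rw [SimpleGraph.dist_comm, hx] at hp
  cases p with
  | nil => simp at hp
  | @cons _ v _ hxv q =>
    refine ⟨v, hxv.symm, le_antisymm ?_ ?_⟩
    · rw [SimpleGraph.dist_comm]
      exact Nat.succ.inj hp ▸ SimpleGraph.dist_le q
    · have := dist_le_succ_of_adj hG (r := r) hxv.symm
      omega

/-- Every parent pointer leads one step closer to `r`, and only vertices within distance `h` of `r`
have a parent. -/
def IsLayered (G : SimpleGraph V) (r : V) (h : ℕ) (par : V → Option V) : Prop :=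
  ∀ v p, par v = some p → G.dist r v = G.dist r p + 1 ∧ G.dist r v ≤ h

variable {r : V} {h : ℕ} {par : V → Option V}

theorem IsLayered.root_eq_none (hpar : IsLayered G r h par) : par r = none := by
  rw [Option.eq_none_iff_forall_ne_some]
  intro p hp
  simpa using (hpar r p hp).1

theorem IsLayered.ancestor_eq_none (hpar : IsLayered G r h par) (v : V) :
    ancestor par (h + 1) v = none := by
  rcases hp : par v with _ | p
  · rw [ancestor_succ_eq_bind, hp, Option.bind_none]
  · refine ancestor_eq_none_of_decreasing (δ := G.dist r) (fun v p hp => ?_)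
      (Nat.lt_succ_of_le (hpar v p hp).2)
    rw [(hpar v p hp).1]
    exact Nat.lt_succ_self _

end GraphDistance

section BFS

variable {n : ℕ} {G : SimpleGraph (Fin n)} (A : AdjLists G)

/-- The effect of looking at the neighbour `x` of `v` during the breadth-first search. -/
def bfsVisit (v : Fin n) (s : BFSState n) (x : Fin n) : BFSState n :=
  if s.visited x then s
  else ⟨Function.update s.visited x true, Function.update s.par x (some v), x :: s.fresh⟩

theorem bfsScan_val (s : BFSState n) (v : Fin n) :
    (bfsScan A s v).val = (A.nbrs v).foldl (bfsVisit v) s := by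
  simp only [bfsScan, Timed.bind_val, Timed.foldlM_val]
  congr 1
  funext s x
  rw [bfsVisit]
  split_ifs <;> rfl

theorem bfsScan_time_le (s : BFSState n) (v : Fin n) :
    (bfsScan A s v).time ≤ 1 + (A.nbrs v).length := by
  simp only [bfsScan, Timed.bind_time, tick_time]
  gcongr
  refine (Timed.foldlM_time_le (g := fun _ => 1) (fun s x => ?_) _ _).trans (by simp)
  simp only [Timed.bind_time, tick_time]
  split_ifs <;> simp

/-- The remaining work of the breadth-first search: the scans of the vertices of the next level and
of those which have not been visited. -/
def bfsWeight (s : BFSState n) : ℕ :=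
  (s.fresh.map fun v => 1 + (A.nbrs v).length).sum +
    ∑ v with s.visited v = false, (1 + (A.nbrs v).length)

theorem filter_update_visited (visited : Fin n → Bool) (x : Fin n) :
    ({v | Function.update visited x true v = false} : Finset (Fin n)) =
      ({v | visited v = false} : Finset (Fin n)).erase x := by
  ext v
  by_cases hv : v = x <;> simp [hv]

theorem bfsWeight_bfsVisit (v : Fin n) (s : BFSState n) (x : Fin n) :
    bfsWeight A (bfsVisit v s x) = bfsWeight A s := by
  rw [bfsVisit]
  split_ifs with hx
  · rfl
  · simp only [bfsWeight, List.map_cons, List.sum_cons, filter_update_visited]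
    rw [← Finset.add_sum_erase {v | s.visited v = false} _
      (Finset.mem_filter.2 ⟨Finset.mem_univ x, by simpa using hx⟩)]
    ring

theorem bfsWeight_foldl_bfsScan (l : List (Fin n)) (s : BFSState n) :
    bfsWeight A (l.foldl (fun s v => (bfsScan A s v).val) s) = bfsWeight A s := by
  refine foldl_invariant (I := fun t => bfsWeight A t = bfsWeight A s) rfl fun t v _ ht => ?_
  rw [bfsScan_val]
  exact foldl_invariant (I := fun t => bfsWeight A t = bfsWeight A s) ht
    fun t x _ ht => (bfsWeight_bfsVisit A v t x).trans ht

theorem bfsLevels_time_le (f h : ℕ) (s : BFSState n) :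
    (bfsLevels A f h s).time ≤ f + bfsWeight A s := by
  induction f generalizing h s with
  | zero => simp [bfsLevels]
  | succ f ih =>
    have scan_le := Timed.foldlM_time_le (bfsScan_time_le A) s.fresh { s with fresh := [] }
    have weight_eq : (s.fresh.map fun v => 1 + (A.nbrs v).length).sum +
        bfsWeight A (s.fresh.foldlM (bfsScan A) { s with fresh := [] }).val = bfsWeight A s := by
      rw [Timed.foldlM_val, bfsWeight_foldl_bfsScan]
      simp [bfsWeight]
    simp only [bfsLevels, Timed.bind_time, tick_time]
    split_ifs
    · simp only [Timed.pure_time]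
      omega
    · have := ih (h + 1) (s.fresh.foldlM (bfsScan A) { s with fresh := [] }).val
      omega

theorem bfs_time_le (r : Fin n) : (bfs A r).time ≤ 4 * n + ∑ v, (A.nbrs v).length := by
  have weight_eq : bfsWeight A ⟨Function.update (fun _ => false) r true, fun _ => none, [r]⟩ =
      n + ∑ v, (A.nbrs v).length := by
    simp only [bfsWeight, filter_update_visited, List.map_cons, List.map_nil, List.sum_singleton]
    rw [Finset.filter_true, Finset.add_sum_erase _ (fun v => 1 + (A.nbrs v).length)
      (Finset.mem_univ r), Finset.sum_add_distrib]
    simp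
  have levels_le := bfsLevels_time_le A n 0
    ⟨Function.update (fun _ => false) r true, fun _ => none, [r]⟩
  simp only [bfs, Timed.bind_time, tick_time]
  omega

/-- The state of the breadth-first search from `r` while the vertices at distance `h` are scanned;
`N` is the set of those neighbours of theirs that have been looked at. -/
structure BFSInvariant (G : SimpleGraph (Fin n)) (r : Fin n) (h : ℕ) (N : Set (Fin n))
    (s : BFSState n) : Prop where
  visited_iff : ∀ v, s.visited v = true ↔ G.dist r v ≤ h ∨ v ∈ N
  mem_fresh_iff : ∀ v, v ∈ s.fresh ↔ h < G.dist r v ∧ v ∈ N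
  isLayered : IsLayered G r (h + 1) s.par

theorem foldl_invariant_iUnion {σ β α : Type} {f : σ → β → σ} {I : Set α → σ → Prop}
    {g : β → Set α} {l : List β} {N : Set α} {s : σ} (hs : I N s)
    (h : ∀ N s, ∀ b ∈ l, I N s → I (N ∪ g b) (f s b)) :
    I (N ∪ ⋃ b ∈ l, g b) (l.foldl f s) := by
  induction l generalizing N s with
  | nil => simpa using hs
  | cons b l ih =>
    have := ih (h N s b (by simp) hs) fun N s b hb => h N s b (by simp [hb])
    simpa [Set.union_assoc] using this

variable {A} {r : Fin n} {h : ℕ} {s : BFSState n}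

theorem BFSInvariant.visit (hG : G.Connected) {N : Set (Fin n)} (hs : BFSInvariant G r h N s)
    {v x : Fin n} (hv : G.dist r v = h) (hx : G.Adj v x) :
    BFSInvariant G r h (N ∪ {x}) (bfsVisit v s x) := by
  have dist_le := dist_le_succ_of_adj hG (r := r) hx
  rw [bfsVisit]
  split_ifs with hvis
  · have hxN : h < G.dist r x → x ∈ N := fun hlt =>
      ((hs.visited_iff x).1 hvis).resolve_left hlt.not_ge
    refine ⟨fun u => ?_, fun u => ?_, hs.isLayered⟩ <;> by_cases hux : u = x
    · subst hux; simp [hvis]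
    · simp [hux, hs.visited_iff]
    · subst hux; simpa [hs.mem_fresh_iff] using hxN
    · simp [hux, hs.mem_fresh_iff]
  · have dist_gt : h < G.dist r x := not_le.1 fun hle => hvis ((hs.visited_iff x).2 (Or.inl hle))
    refine ⟨fun u => ?_, fun u => ?_, fun u p hp => ?_⟩ <;> by_cases hux : u = x
    · simp [hux]
    · simp [hux, hs.visited_iff]
    · simpa [hux] using dist_gt
    · simp [hux, hs.mem_fresh_iff]
    · subst hux
      obtain rfl : v = p := by simpa using hp
      omega
    · exact hs.isLayered u p (by simpa [hux] using hp)

theorem BFSInvariant.scanLevel (hG : G.Connected) {l : List (Fin n)}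
    (hl : ∀ v ∈ l, G.dist r v = h) (hs : BFSInvariant G r h ∅ s) :
    BFSInvariant G r h (⋃ v ∈ l, G.neighborSet v) (l.foldl (fun s v => (bfsScan A s v).val) s) := by
  rw [← Set.empty_union (⋃ v ∈ l, G.neighborSet v)]
  refine foldl_invariant_iUnion hs fun N s v hv hs => ?_
  have nbrs_eq : G.neighborSet v = ⋃ x ∈ A.nbrs v, {x} := by
    ext x
    simp [A.mem_nbrs]
  rw [bfsScan_val, nbrs_eq]
  exact foldl_invariant_iUnion hs fun N s x hx hs =>
    hs.visit hG (hl v hv) ((A.mem_nbrs v x).1 hx)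

/-- The state of the breadth-first search from `r` when the level at distance `h` is complete. -/
structure BFSLevelComplete (G : SimpleGraph (Fin n)) (r : Fin n) (h : ℕ) (s : BFSState n) :
    Prop where
  visited_iff : ∀ v, s.visited v = true ↔ G.dist r v ≤ h
  mem_fresh_iff : ∀ v, v ∈ s.fresh ↔ G.dist r v = h
  isLayered : IsLayered G r h s.par

theorem BFSLevelComplete.next (hG : G.Connected) (hs : BFSLevelComplete G r h s) :
    BFSLevelComplete G r (h + 1) (s.fresh.foldlM (bfsScan A) { s with fresh := [] }).val := by
  have hinv : BFSInvariant G r h ∅ { s with fresh := [] } :=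
    ⟨by simpa using hs.visited_iff, by simp, fun v p hp =>
      ⟨(hs.isLayered v p hp).1, (hs.isLayered v p hp).2.trans (Nat.le_succ h)⟩⟩
  have hscan := hinv.scanLevel (A := A) hG fun v => (hs.mem_fresh_iff v).1
  have mem_iff (v : Fin n) (hv : h < G.dist r v) :
      v ∈ ⋃ w ∈ s.fresh, G.neighborSet w ↔ G.dist r v = h + 1 := by
    simp only [Set.mem_iUnion, SimpleGraph.mem_neighborSet, hs.mem_fresh_iff, exists_prop]
    constructor
    · rintro ⟨w, hw, hwv⟩
      have := dist_le_succ_of_adj hG (r := r) hwv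
      omega
    · intro hv
      obtain ⟨w, hwv, hw⟩ := exists_adj_dist_eq hG hv
      exact ⟨w, hw, hwv⟩
  rw [Timed.foldlM_val]
  refine ⟨fun v => ?_, fun v => ?_, hscan.isLayered⟩
  · rw [hscan.visited_iff]
    rcases le_or_gt (G.dist r v) h with hv | hv
    · simp only [hv, true_or, true_iff]; omega
    · rw [mem_iff v hv]; omega
  · rw [hscan.mem_fresh_iff, and_congr_right (mem_iff v)]
    omega

theorem bfsLevels_spec (hG : G.Connected) (f : ℕ) (hs : BFSLevelComplete G r h s)
    (hne : s.fresh ≠ []) :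
    (∃ v, G.dist r v = (bfsLevels A f h s).val.2) ∧
      IsLayered G r (bfsLevels A f h s).val.2 (bfsLevels A f h s).val.1 := by
  obtain ⟨w, hw⟩ := List.exists_mem_of_ne_nil _ hne
  rw [hs.mem_fresh_iff] at hw
  induction f generalizing h s w with
  | zero => exact ⟨⟨w, hw⟩, hs.isLayered⟩
  | succ f ih =>
    have hnext := hs.next (A := A) hG
    simp only [bfsLevels, Timed.bind_val]
    generalize (s.fresh.foldlM (bfsScan A) { s with fresh := [] }).val = t at hnext ⊢
    split_ifs with he
    · refine ⟨⟨w, hw⟩, fun v p hp => ?_⟩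
      have dist_ne : G.dist r v ≠ h + 1 := by
        simp [← hnext.mem_fresh_iff, List.isEmpty_iff.1 he]
      have := hnext.isLayered v p hp
      simp only [Timed.pure_val]
      omega
    · obtain ⟨x, hx⟩ := List.exists_mem_of_ne_nil t.fresh (by simpa using he)
      exact ih hnext (List.ne_nil_of_mem hx) x ((hnext.mem_fresh_iff x).1 hx)

theorem bfs_spec (hG : G.Connected) (A : AdjLists G) (r : Fin n) :
    (bfs A r).val.2 ≤ G.diam ∧ IsLayered G r (bfs A r).val.2 (bfs A r).val.1 := by
  have : Nonempty (Fin n) := ⟨r⟩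
  have hinit : BFSLevelComplete G r 0
      ⟨Function.update (fun _ => false) r true, fun _ => none, [r]⟩ := by
    refine ⟨fun v => ?_, fun v => ?_, by simp [IsLayered]⟩
    · rw [Nat.le_zero, hG.dist_eq_zero_iff, eq_comm (a := r)]
      by_cases hv : v = r <;> simp [hv]
    · rw [hG.dist_eq_zero_iff, List.mem_singleton, eq_comm]
  obtain ⟨⟨v, hv⟩, hlayered⟩ := bfsLevels_spec (A := A) hG n hinit (by simp)
  exact ⟨hv.symm.trans_le
    (SimpleGraph.dist_le_diam (SimpleGraph.connected_iff_ediam_ne_top.1 hG)), hlayered⟩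

end BFS

/-! ### Preprocessing and the choice of the data structure -/

section EdgesAndDiameter

variable {V : Type*} [Nontrivial V] {G : SimpleGraph V}

theorem card_le_two_mul_card_edgeFinset [Fintype V] [DecidableRel G.Adj] (hG : G.Connected) :
    Fintype.card V ≤ 2 * G.edgeFinset.card := by
  have := hG.card_vert_le_card_edgeSet_add_one
  rw [Nat.card_eq_fintype_card, Nat.card_eq_fintype_card, ← SimpleGraph.edgeFinset_card] at this
  have := Fintype.one_lt_card (α := V)
  omega

theorem one_le_diam [Finite V] (hG : G.Connected) : 1 ≤ G.diam :=
  Nat.one_le_iff_ne_zero.2 <| SimpleGraph.diam_ne_zero_of_ediam_ne_top <|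
    SimpleGraph.connected_iff_ediam_ne_top.1 hG

end EdgesAndDiameter

theorem half_le_log {n : ℕ} (hn : 2 ≤ n) : (1 : ℝ) / 2 ≤ Real.log n := by
  have : Real.log 2 ≤ Real.log n := Real.log_le_log (by norm_num) (by exact_mod_cast hn)
  linarith [Real.log_two_gt_d9]

theorem natLog_two_le_two_mul_log {n : ℕ} (hn : 2 ≤ n) : (Nat.log 2 n : ℝ) ≤ 2 * Real.log n := by
  refine (Real.natLog_le_logb n 2).trans ?_
  rw [Real.logb, Nat.cast_ofNat, div_le_iff₀ (Real.log_pos one_lt_two)]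
  nlinarith [Real.log_two_gt_d9, half_le_log hn]

section Preprocessing

variable {n : ℕ} {G : SimpleGraph (Fin n)}

theorem AdjLists.toFinset_nbrs [DecidableRel G.Adj] (A : AdjLists G) (v : Fin n) :
    (A.nbrs v).toFinset = G.neighborFinset v := by
  ext w
  simp [A.mem_nbrs]

theorem AdjLists.length_nbrs [DecidableRel G.Adj] (A : AdjLists G) (v : Fin n) :
    (A.nbrs v).length = G.degree v := by
  rw [← List.toFinset_card_of_nodup (A.nodup v), A.toFinset_nbrs,
    SimpleGraph.card_neighborFinset_eq_degree]

theorem preprocess_mode (A : AdjLists G) (r : Fin n) :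
    (preprocess A r).val.mode =
      if (bfs A r).val.2 ≤ Nat.log 2 n then Mode.path else Mode.bit := rfl

theorem preprocess_dfn (A : AdjLists G) (r : Fin n) :
    (preprocess A r).val.dfn = (dfnFrom (childLists (bfs A r).val.1).val n r
      ⟨0, fun _ => 0, fun _ => 0⟩).val := rfl

theorem treeSum_bfs_le (hG : G.Connected) (A : AdjLists G) (r : Fin n) (c : ℕ) :
    treeSum (childLists (bfs A r).val.1).val (fun _ => c) n r ≤ n * c := by
  simpa using treeSum_root_le (enumeratesChildren_childLists _) (bfs_spec hG A r).2.root_eq_none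
    (fun _ => c) n

theorem preprocess_time_le [DecidableRel G.Adj] (hn : 2 ≤ n) (hG : G.Connected) (A : AdjLists G)
    (r : Fin n) : (preprocess A r).time ≤ 30 * G.edgeFinset.card := by
  have : Nontrivial (Fin n) := Fin.nontrivial_iff_two_le.2 hn
  have bfs_le := bfs_time_le A r
  have children_le := childLists_time_le (bfs A r).val.1
  have dfn_le := (dfnFrom_time_le (childLists (bfs A r).val.1).val n r
    ⟨0, fun _ => 0, fun _ => 0⟩).trans (treeSum_bfs_le hG A r 2)
  have twoM_le := Timed.foldlM_time_le (f := fun (s : ℤ) v => do tick; return s + A.deg v)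
    (g := fun _ => 1) (fun s v => by simp) (List.finRange n) 0
  have log_le : Nat.log 2 n ≤ n := Nat.log_le_self 2 n
  have card_le := card_le_two_mul_card_edgeFinset hG
  simp only [A.length_nbrs, SimpleGraph.sum_degrees_eq_twice_card_edges] at bfs_le
  simp only [List.map_const', List.sum_replicate, List.length_finRange, smul_eq_mul,
    mul_one] at twoM_le
  rw [Fintype.card_fin] at card_le
  simp only [preprocess, Timed.bind_time, Timed.pure_time, tick_time]
  omega

theorem preprocess_dfsIn_le (hG : G.Connected) (A : AdjLists G) (r v : Fin n) :
    (preprocess A r).val.dfn.dfsIn v ≤ n := by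
  rw [preprocess_dfn]
  refine (dfnFrom_dfsIn_le_clock _ _ _ (fun _ => le_rfl) v).trans ?_
  rw [dfnFrom_clock, zero_add]
  simpa using treeSum_bfs_le hG A r 1

variable (hG : G.Connected) (A : AdjLists G) {r : Fin n} {τ : Parents n} (hτ : τ r = none)
  (s : ℤ × (ℕ → ℤ))

include hG hτ

theorem processSample_bit_time_le :
    (processSample A r (preprocess A r).val .bit τ s).time ≤ n * (16 + 5 * Nat.log 2 n) := by
  refine (processSample_time_le_of_volSum A (U := 2 * (Nat.log 2 n + 2)) (Q := Nat.log 2 n + 2)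
    (fun u x a => ?_) (fun v a => ?_) hτ s).trans_eq (by ring)
  · simp only [volSumAdd, Timed.bind_time, two_mul]
    exact Nat.add_le_add (bitAdd_time_le _ _ _ _) (bitAdd_time_le _ _ _ _)
  · refine (bitSum_time_le a _).trans ?_
    gcongr
    exact preprocess_dfsIn_le hG A r v

theorem processSample_path_time_le :
    (processSample A r (preprocess A r).val .path τ s).time ≤ n * (9 + (bfs A r).val.2) := by
  refine (processSample_time_le_of_volSum A (U := 1) (Q := (bfs A r).val.2 + 1)
    (fun u x a => ?_) (fun v a => ?_) hτ s).trans_eq (by ring)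
  · simp [volSumAdd]
  · exact pathSum_time_le ((bfs_spec hG A r).2.ancestor_eq_none v) _ _

variable (hn : 2 ≤ n)

include hn

theorem processSample_bit_time_le_log :
    ((processSample A r (preprocess A r).val .bit τ s).time : ℝ) ≤ 42 * (n * Real.log n) :=
  calc _ ≤ (n * (16 + 5 * Nat.log 2 n) : ℝ) := by
        exact_mod_cast processSample_bit_time_le hG A hτ s
    _ ≤ n * (42 * Real.log n) := by
        gcongr
        linarith [half_le_log hn, natLog_two_le_two_mul_log hn]
    _ = 42 * (n * Real.log n) := mul_left_comm _ _ _

theorem processSample_path_time_le_diam :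
    ((processSample A r (preprocess A r).val .path τ s).time : ℝ) ≤ 42 * (n * G.diam) := by
  have : Nontrivial (Fin n) := Fin.nontrivial_iff_two_le.2 hn
  have bound : (processSample A r (preprocess A r).val .path τ s).time ≤ n * (42 * G.diam) := by
    refine (processSample_path_time_le hG A hτ s).trans (Nat.mul_le_mul_left n ?_)
    have := (bfs_spec hG A r).1
    have := one_le_diam hG
    omega
  rw [mul_left_comm]
  exact_mod_cast bound

theorem processSample_time_le :
    ((processSample A r (preprocess A r).val (preprocess A r).val.mode τ s).time : ℝ) ≤
      42 * (n * min (G.diam : ℝ) (Real.log n)) := by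
  have : Nontrivial (Fin n) := Fin.nontrivial_iff_two_le.2 hn
  have height_le : ((bfs A r).val.2 : ℝ) ≤ G.diam := by exact_mod_cast (bfs_spec hG A r).1
  have one_le : (1 : ℝ) ≤ G.diam := by exact_mod_cast one_le_diam hG
  have half_le := half_le_log hn
  have log_le := natLog_two_le_two_mul_log hn
  rw [preprocess_mode, mul_min_of_nonneg _ _ n.cast_nonneg, mul_min_of_nonneg _ _ (by norm_num),
    le_min_iff]
  split_ifs with hmode
  · refine ⟨processSample_path_time_le_diam hG A hτ s hn, ?_⟩
    have hmode : ((bfs A r).val.2 : ℝ) ≤ Nat.log 2 n := by exact_mod_cast hmode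
    calc _ ≤ (n * (9 + (bfs A r).val.2) : ℝ) := by
          exact_mod_cast processSample_path_time_le hG A hτ s
      _ ≤ n * (42 * Real.log n) := by gcongr; linarith
      _ = 42 * (n * Real.log n) := mul_left_comm _ _ _
  · refine ⟨?_, processSample_bit_time_le_log hG A hτ s hn⟩
    have hmode : (Nat.log 2 n : ℝ) ≤ (bfs A r).val.2 := by exact_mod_cast (not_le.1 hmode).le
    calc _ ≤ (n * (16 + 5 * Nat.log 2 n) : ℝ) := by
          exact_mod_cast processSample_bit_time_le hG A hτ s
      _ ≤ n * (42 * G.diam) := by gcongr; linarith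
      _ = 42 * (n * G.diam) := mul_left_comm _ _ _

end Preprocessing

/-! ### Randomized computations with a cost limit -/

section Prog

variable {α β γ : Type}

theorem tsum_option_eq_add (f : Option α → ℝ≥0∞) :
    ∑' x, f x = f none + ∑' a, f (some a) := by
  rw [← (Equiv.optionEquivSumPUnit.{0} α).symm.tsum_eq,
    Summable.tsum_sum ENNReal.summable ENNReal.summable, add_comm]
  simp

theorem tsum_ite_le_sub (f : ℕ → ℝ≥0∞) (s : ℕ) :
    ∑' t, (if s ≤ t then f (t - s) else 0) = ∑' c, f c := by
  rw [← (add_left_injective s).tsum_eq (f := fun t => if s ≤ t then f (t - s) else 0)]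
  · simp
  · intro t ht
    by_cases h : s ≤ t
    · exact ⟨t - s, Nat.sub_add_cancel h⟩
    · simp [h] at ht

namespace Prog

theorem bind_apply (p : Prog α) (f : α → Prog β) (t : ℕ) (b : Option (β × ℕ)) :
    (p >>= f) t b = p t none * (PMF.pure none : PMF (Option (β × ℕ))) b +
      ∑' a, ∑' s, p t (some (a, s)) * f a s b := by
  change (PMF.bind (p t) _) b = _
  rw [PMF.bind_apply, tsum_option_eq_add, ENNReal.tsum_prod']

theorem bind_apply_some (p : Prog α) (f : α → Prog β) (t : ℕ) (b : β × ℕ) :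
    (p >>= f) t (some b) = ∑' a, ∑' s, p t (some (a, s)) * f a s (some b) := by
  simp [bind_apply]

theorem bind_apply_congr {p : Prog α} {f g : α → Prog β} {t : ℕ}
    (h : ∀ a s, p t (some (a, s)) ≠ 0 → f a s = g a s) : (p >>= f) t = (p >>= g) t := by
  ext b
  rw [bind_apply, bind_apply]
  congr 1
  refine tsum_congr fun a => tsum_congr fun s => ?_
  by_cases hs : p t (some (a, s)) = 0
  · rw [hs, zero_mul, zero_mul]
  · rw [h a s hs]

instance : LawfulMonad Prog := LawfulMonad.mk'
  (id_map := fun p => by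
    funext t
    refine Eq.trans ?_ (PMF.bind_pure (p t))
    change PMF.bind (p t) _ = _
    congr 1
    funext x
    cases x <;> rfl)
  (pure_bind := fun _ _ => by
    funext t
    exact PMF.pure_bind _ _)
  (bind_assoc := fun p f g => by
    funext t
    refine (PMF.bind_bind (p t) _ _).trans ?_
    change _ = PMF.bind (p t) _
    congr 1
    funext x
    cases x
    · exact PMF.pure_bind _ _
    · rfl)

/-- A cost limit does not influence a computation that stays below it: whether the result `a` is
reached at the cost `c` is decided in the same way for all limits `t = c + s`. -/
def IsLimitInvariant (p : Prog α) : Prop :=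
  ∀ t a s, p t (some (a, s)) = if s ≤ t then p (t - s) (some (a, 0)) else 0

/-- The probability of the result `a` when there is no cost limit: a run of cost exactly `c` is the
one that uses up the limit `c`. -/
noncomputable def outputProb (p : Prog α) (a : α) : ℝ≥0∞ := ∑' c, p c (some (a, 0))

/-- All results that are returned with positive probability satisfy `Q`. -/
def Ensures (p : Prog α) (Q : α → Prop) : Prop :=
  ∀ t a s, p t (some (a, s)) ≠ 0 → Q a

/-- A random result with law `μ`, at the cost `k`. -/
noncomputable def delayed (k : ℕ) (μ : PMF α) : Prog α := fun t =>
  if k ≤ t then μ.map fun a => some (a, t - k) else PMF.pure none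

theorem delayed_apply_some (k : ℕ) (μ : PMF α) (t : ℕ) (a : α) (s : ℕ) :
    delayed k μ t (some (a, s)) = if s + k = t then μ a else 0 := by
  classical
  by_cases hk : k ≤ t
  · have hs : s = t - k ↔ s + k = t := by omega
    simp only [delayed, hk, if_true, PMF.map_apply, Option.some.injEq, Prod.mk.injEq, hs]
    split_ifs with h
    · simp [h]
    · simp [h]
  · simp [delayed, hk, show s + k ≠ t by omega]

theorem delayed_apply_none (k : ℕ) (μ : PMF α) (t : ℕ) :
    delayed k μ t none = if t < k then 1 else 0 := by
  by_cases hk : k ≤ t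
  · simp [delayed, hk, PMF.map_apply]
  · simp [delayed, hk, not_le.1 hk]

theorem add_eq_of_delayed_ne_zero {k : ℕ} {μ : PMF α} {t s : ℕ} {a : α}
    (h : delayed k μ t (some (a, s)) ≠ 0) : s + k = t := by
  rw [delayed_apply_some] at h
  exact (ite_ne_right_iff.1 h).1

theorem delayed_bind_apply_add (k : ℕ) (μ : PMF α) (f : α → Prog β) (t : ℕ) :
    (delayed k μ >>= f) (k + t) = μ.bind fun a => f a t := by
  change PMF.bind (delayed k μ (k + t)) _ = _
  rw [delayed, if_pos (Nat.le_add_right k t), PMF.bind_map, Nat.add_sub_cancel_left]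
  rfl

theorem pure_eq_delayed (a : α) : (pure a : Prog α) = delayed 0 (PMF.pure a) := by
  funext t
  simp only [delayed, Nat.zero_le, if_true, PMF.pure_map]
  rfl

theorem runTimed_eq_delayed (w : CostModel) (c : Timed α) :
    runTimed w c = delayed (w.basic * c.time) (PMF.pure c.val) := by
  funext t
  simp only [runTimed, delayed, PMF.pure_map]

section LimitInvariance

theorem isLimitInvariant_delayed (k : ℕ) (μ : PMF α) : (delayed k μ).IsLimitInvariant := by
  intro t a s
  simp only [delayed_apply_some]
  split_ifs <;> first | rfl | omega

theorem isLimitInvariant_pure (a : α) : IsLimitInvariant (pure a : Prog α) := by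
  rw [pure_eq_delayed]
  exact isLimitInvariant_delayed _ _

theorem isLimitInvariant_runTimed (w : CostModel) (c : Timed α) :
    (runTimed w c).IsLimitInvariant := by
  rw [runTimed_eq_delayed]
  exact isLimitInvariant_delayed _ _

theorem IsLimitInvariant.bind {p : Prog α} (hp : p.IsLimitInvariant) {f : α → Prog β}
    (hf : ∀ a, (f a).IsLimitInvariant) : (p >>= f).IsLimitInvariant := by
  intro t b s
  have shift_limit : ∀ a, ∑' s', p t (some (a, s')) * f a s' (some (b, s)) =
      ∑' c, p t (some (a, c + s)) * f a c (some (b, 0)) := by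
    intro a
    rw [← tsum_ite_le_sub (fun c => p t (some (a, c + s)) * f a c (some (b, 0))) s]
    refine tsum_congr fun s' => ?_
    rw [hf a s' b s]
    split_ifs with hs
    · rw [Nat.sub_add_cancel hs]
    · exact mul_zero _
  simp only [bind_apply_some, shift_limit]
  split_ifs with hs
  · refine tsum_congr fun a => tsum_congr fun c => ?_
    rw [hp t a (c + s), hp (t - s) a c]
    by_cases hc : c + s ≤ t
    · rw [if_pos hc, if_pos (by omega), Nat.sub_sub, add_comm s c]
    · rw [if_neg hc, if_neg (by omega)]
  · refine ENNReal.tsum_eq_zero.2 fun a => ENNReal.tsum_eq_zero.2 fun c => ?_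
    rw [hp t a (c + s), if_neg (by omega), zero_mul]

theorem isLimitInvariant_foldlM {f : β → α → Prog β} (hf : ∀ b a, (f b a).IsLimitInvariant)
    (l : List α) (b : β) : (l.foldlM f b).IsLimitInvariant := by
  induction l generalizing b with
  | nil => exact isLimitInvariant_pure b
  | cons a l ih => exact (hf b a).bind ih

end LimitInvariance

section ExpectedCost

theorem expectedCost_delayed (k : ℕ) (μ : PMF α) : expectedCost (delayed k μ) = k := by
  simp only [expectedCost, delayed_apply_none, ← Finset.mem_range]
  rw [tsum_eq_sum fun t ht => if_neg ht, Finset.sum_ite_mem]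
  simp

theorem outputProb_delayed (k : ℕ) (μ : PMF α) (a : α) : outputProb (delayed k μ) a = μ a := by
  simp [outputProb, delayed_apply_some]

theorem expectedCost_pure (a : α) : expectedCost (pure a : Prog α) = 0 := by
  rw [pure_eq_delayed, expectedCost_delayed, Nat.cast_zero]

theorem expectedCost_bind {p : Prog α} (hp : p.IsLimitInvariant) (f : α → Prog β) :
    expectedCost (p >>= f) = expectedCost p + ∑' a, p.outputProb a * expectedCost (f a) := by
  simp only [expectedCost, bind_apply, PMF.pure_apply, if_true, mul_one]
  rw [ENNReal.tsum_add, ENNReal.tsum_comm]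
  congr 1
  refine tsum_congr fun a => ?_
  have cost_split : ∀ s, ∑' t, p t (some (a, s)) * f a s none = p.outputProb a * f a s none := by
    intro s
    rw [outputProb, ← ENNReal.tsum_mul_right,
      ← tsum_ite_le_sub (fun c => p c (some (a, 0)) * f a s none) s]
    refine tsum_congr fun t => ?_
    rw [hp t a s]
    split_ifs <;> simp
  rw [ENNReal.tsum_comm, tsum_congr cost_split, ENNReal.tsum_mul_left]

theorem expectedCost_delayed_bind (k : ℕ) (μ : PMF α) (f : α → Prog β) :
    expectedCost (delayed k μ >>= f) = k + ∑' a, μ a * expectedCost (f a) := by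
  simp only [expectedCost_bind (isLimitInvariant_delayed k μ), expectedCost_delayed,
    outputProb_delayed]

theorem expectedCost_runTimed_bind (w : CostModel) (c : Timed α) (f : α → Prog β) :
    expectedCost (runTimed w c >>= f) = (w.basic * c.time : ℕ) + expectedCost (f c.val) := by
  rw [runTimed_eq_delayed, expectedCost_delayed_bind, tsum_eq_single c.val fun a ha => by simp [ha]]
  simp

theorem sum_range_delayed_bind_le (k : ℕ) (μ : PMF α) (f : α → Prog β) (N : ℕ) :
    ∑ t ∈ Finset.range N, (delayed k μ >>= f) t none ≤
      k + ∑' a, μ a * ∑ t ∈ Finset.range (N - k), f a t none := by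
  have le_one : ∀ t, (delayed k μ >>= f) t none ≤ 1 := fun t => PMF.coe_le_one _ _
  obtain hN | ⟨M, rfl⟩ := (le_total N k).imp_right Nat.exists_eq_add_of_le
  · calc ∑ t ∈ Finset.range N, (delayed k μ >>= f) t none
        ≤ ∑ t ∈ Finset.range N, 1 := Finset.sum_le_sum fun t _ => le_one t
      _ = N := by simp
      _ ≤ k := Nat.cast_le.2 hN
      _ ≤ _ := le_self_add
  · rw [Finset.sum_range_add, Nat.add_sub_cancel_left]
    refine add_le_add ((Finset.sum_le_sum fun t _ => le_one t).trans (by simp)) (le_of_eq ?_)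
    simp only [delayed_bind_apply_add, PMF.bind_apply, Finset.mul_sum]
    rw [Summable.tsum_finsetSum fun _ _ => ENNReal.summable]

/-- A run of cost `c ≤ N` leaves `N - c` of the limit `N`, and the outcomes with limit `N` are
disjoint events. -/
theorem IsLimitInvariant.tsum_outputProb_le {p : Prog α} (hp : p.IsLimitInvariant) :
    ∑' a, p.outputProb a ≤ 1 := by
  simp only [outputProb]
  rw [ENNReal.tsum_comm, ENNReal.tsum_eq_iSup_nat]
  refine iSup_le fun N => ?_
  calc ∑ c ∈ Finset.range N, ∑' a, p c (some (a, 0))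
      = ∑ c ∈ Finset.range N, ∑' a, p (N - 1) (some (a, N - 1 - c)) := by
        refine Finset.sum_congr rfl fun c hc => tsum_congr fun a => ?_
        have := Finset.mem_range.1 hc
        rw [hp (N - 1) a, if_pos (Nat.sub_le _ _), Nat.sub_sub_self (by omega)]
    _ = ∑ s ∈ Finset.range N, ∑' a, p (N - 1) (some (a, s)) :=
        Finset.sum_range_reflect (fun s => ∑' a, p (N - 1) (some (a, s))) N
    _ ≤ ∑' s, ∑' a, p (N - 1) (some (a, s)) := ENNReal.sum_le_tsum _
    _ = ∑' x, p (N - 1) (some x) := by rw [ENNReal.tsum_comm, ENNReal.tsum_prod']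
    _ ≤ ∑' x, p (N - 1) x := by rw [tsum_option_eq_add]; exact le_add_self
    _ = 1 := (p (N - 1)).tsum_coe

theorem Ensures.of_outputProb_ne_zero {p : Prog α} {Q : α → Prop} (h : p.Ensures Q) {a : α}
    (ha : p.outputProb a ≠ 0) : Q a := by
  rw [outputProb, Ne, ENNReal.tsum_eq_zero, not_forall] at ha
  obtain ⟨c, hc⟩ := ha
  exact h c a 0 hc

theorem expectedCost_bind_le {p : Prog α} (hp : p.IsLimitInvariant) {Q : α → Prop}
    (hQ : p.Ensures Q) {f : α → Prog β} {K : ℝ≥0∞} (hK : ∀ a, Q a → expectedCost (f a) ≤ K) :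
    expectedCost (p >>= f) ≤ expectedCost p + K := by
  rw [expectedCost_bind hp]
  gcongr
  calc ∑' a, p.outputProb a * expectedCost (f a) ≤ ∑' a, p.outputProb a * K := by
        refine ENNReal.tsum_le_tsum fun a => ?_
        by_cases ha : p.outputProb a = 0
        · simp [ha]
        · gcongr
          exact hK a (hQ.of_outputProb_ne_zero ha)
    _ = (∑' a, p.outputProb a) * K := ENNReal.tsum_mul_right
    _ ≤ 1 * K := by gcongr; exact hp.tsum_outputProb_le
    _ = K := one_mul K

end ExpectedCost

section Ensures

variable {Q : α → Prop}

theorem ensures_delayed {k : ℕ} {μ : PMF α} (h : ∀ a, μ a ≠ 0 → Q a) :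
    (delayed k μ).Ensures Q := by
  intro t a s has
  rw [delayed_apply_some] at has
  exact h a (ite_ne_right_iff.1 has).2

theorem ensures_pure {a : α} (h : Q a) : Ensures (pure a : Prog α) Q := by
  rw [pure_eq_delayed]
  refine ensures_delayed fun b hb => ?_
  obtain rfl : b = a := by simpa using hb
  exact h

theorem ensures_runTimed {w : CostModel} {c : Timed α} (h : Q c.val) :
    (runTimed w c).Ensures Q := by
  rw [runTimed_eq_delayed]
  refine ensures_delayed fun b hb => ?_
  obtain rfl : b = c.val := by simpa using hb
  exact h

theorem Ensures.bind {p : Prog α} {f : α → Prog β} {R : β → Prop} (hp : p.Ensures Q)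
    (hf : ∀ a, Q a → (f a).Ensures R) : (p >>= f).Ensures R := by
  intro t b s h
  simp only [bind_apply_some, ne_eq, ENNReal.tsum_eq_zero, not_forall, mul_eq_zero, not_or] at h
  obtain ⟨a, s', ha, hb⟩ := h
  exact hf a (hp t a s' ha) s' b s hb

end Ensures

end Prog

end Prog

/-! ### Random walks on graphs -/

section Walk

variable {n : ℕ} {G : SimpleGraph (Fin n)} {w : CostModel}

open Prog

section TransitionMatrix

variable [DecidableRel G.Adj] (hd : ∀ u, G.degree u ≠ 0)
include hd

theorem transitionMatrix_apply (u v : Fin n) :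
    transitionMatrix G u v = if G.Adj u v then (G.degree u : ℝ)⁻¹ else 0 := by
  have inv_diagonal : (Matrix.diagonal fun v => (G.degree v : ℝ))⁻¹ =
      Matrix.diagonal fun v => (G.degree v : ℝ)⁻¹ := by
    refine Matrix.inv_eq_right_inv ?_
    rw [Matrix.diagonal_mul_diagonal, ← Matrix.diagonal_one]
    congr 1
    funext v
    exact mul_inv_cancel₀ (Nat.cast_ne_zero.2 (hd v))
  rw [transitionMatrix, inv_diagonal, Matrix.diagonal_mul, SimpleGraph.adjMatrix_apply,
    mul_ite, mul_one, mul_zero]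

theorem transitionMatrix_nonneg (u v : Fin n) : 0 ≤ transitionMatrix G u v := by
  rw [transitionMatrix_apply hd]
  positivity

theorem transitionMatrix_pos_iff {u v : Fin n} : 0 < transitionMatrix G u v ↔ G.Adj u v := by
  have := Nat.pos_of_ne_zero (hd u)
  rw [transitionMatrix_apply hd]
  split_ifs with h
  · exact iff_of_true (by positivity) h
  · simp [h]

theorem sum_transitionMatrix (u : Fin n) : ∑ v, transitionMatrix G u v = 1 := by
  simp only [transitionMatrix_apply hd]
  rw [← Finset.sum_filter, Finset.sum_const, ← SimpleGraph.neighborFinset_eq_filter,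
    SimpleGraph.card_neighborFinset_eq_degree, nsmul_eq_mul]
  exact mul_inv_cancel₀ (Nat.cast_ne_zero.2 (hd u))

end TransitionMatrix

variable (A : AdjLists G)

theorem toFinset_nbrs_nonempty [DecidableRel G.Adj] (hd : ∀ u, G.degree u ≠ 0) (u : Fin n) :
    (A.nbrs u).toFinset.Nonempty := by
  rw [← Finset.card_pos, A.toFinset_nbrs, SimpleGraph.card_neighborFinset_eq_degree]
  exact Nat.pos_of_ne_zero (hd u)

theorem randomNeighbor_eq_delayed (u : Fin n) :
    ∃ μ, randomNeighbor w A u = delayed w.draw μ := by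
  by_cases h : (A.nbrs u).toFinset.Nonempty
  · exact ⟨PMF.uniformOfFinset _ h, by funext t; simp only [randomNeighbor, delayed, h, dite_true]⟩
  · refine ⟨PMF.pure u, ?_⟩
    funext t
    simp only [randomNeighbor, delayed, h, dite_false, PMF.pure_map]

theorem randomNeighbor_eq_uniform [DecidableRel G.Adj] (hd : ∀ u, G.degree u ≠ 0) (u : Fin n) :
    ∃ μ : PMF (Fin n), (∀ x, μ x = ENNReal.ofReal (transitionMatrix G u x)) ∧
      randomNeighbor w A u = delayed w.draw μ := by
  have nonempty := toFinset_nbrs_nonempty A hd u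
  refine ⟨PMF.uniformOfFinset _ nonempty, fun x => ?_, ?_⟩
  · rw [PMF.uniformOfFinset_apply, transitionMatrix_apply hd]
    simp only [A.toFinset_nbrs, SimpleGraph.card_neighborFinset_eq_degree,
      SimpleGraph.mem_neighborFinset]
    split_ifs
    · rw [ENNReal.ofReal_inv_of_pos (Nat.cast_pos.2 (Nat.pos_of_ne_zero (hd u))),
        ENNReal.ofReal_natCast]
    · simp
  · funext t
    simp only [randomNeighbor, delayed, nonempty, dite_true]

theorem isLimitInvariant_randomNeighbor (u : Fin n) :
    (randomNeighbor w A u).IsLimitInvariant := by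
  obtain ⟨μ, h⟩ := randomNeighbor_eq_delayed (w := w) A u
  rw [h]
  exact isLimitInvariant_delayed _ _

theorem add_draw_eq_of_randomNeighbor_ne_zero {u x : Fin n} {t s : ℕ}
    (h : randomNeighbor w A u t (some (x, s)) ≠ 0) : s + w.draw = t := by
  obtain ⟨μ, hμ⟩ := randomNeighbor_eq_delayed (w := w) A u
  rw [hμ] at h
  exact add_eq_of_delayed_ne_zero h

theorem expectedCost_randomNeighbor_bind [DecidableRel G.Adj] (hd : ∀ u, G.degree u ≠ 0)
    (u : Fin n) {β : Type} (f : Fin n → Prog β) :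
    expectedCost (randomNeighbor w A u >>= f) =
      w.draw + ∑ x, ENNReal.ofReal (transitionMatrix G u x) * expectedCost (f x) := by
  obtain ⟨μ, hμ, h⟩ := randomNeighbor_eq_uniform (w := w) A hd u
  simp only [h, expectedCost_delayed_bind, tsum_fintype, hμ]

theorem ensures_randomNeighbor [DecidableRel G.Adj] (hd : ∀ u, G.degree u ≠ 0) (u : Fin n) :
    (randomNeighbor w A u).Ensures (G.Adj u) := by
  obtain ⟨μ, hμ, h⟩ := randomNeighbor_eq_uniform (w := w) A hd u
  rw [h]
  refine ensures_delayed fun x hx => (transitionMatrix_pos_iff hd).1 ?_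
  rwa [hμ, ne_eq, ENNReal.ofReal_eq_zero, not_le] at hx

section WalkRounds

variable (inTree : Fin n → Bool)

theorem isLimitInvariant_walkRounds (f : ℕ) (u : Fin n) (next : Parents n) :
    (walkRounds w A inTree f u next).IsLimitInvariant := by
  induction f generalizing u next with
  | zero =>
    intro t a s
    simp [walkRounds]
  | succ f ih =>
    refine (isLimitInvariant_runTimed _ _).bind fun _ => ?_
    split_ifs
    · exact isLimitInvariant_pure _
    · exact (isLimitInvariant_randomNeighbor A u).bind fun x => ih x _

variable (hdraw : 1 ≤ w.draw)
include hdraw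

theorem walkRounds_succ_of_le {f t : ℕ} (hf : t + 1 ≤ f) (u : Fin n) (next : Parents n) :
    walkRounds w A inTree (f + 1) u next t = walkRounds w A inTree f u next t := by
  induction f generalizing t u next with
  | zero => omega
  | succ f ih =>
    refine bind_apply_congr fun _ s hs => ?_
    rw [runTimed_eq_delayed] at hs
    have := add_eq_of_delayed_ne_zero hs
    split_ifs
    · rfl
    refine bind_apply_congr fun x s' hs' => ih ?_ x _
    have := add_draw_eq_of_randomNeighbor_ne_zero A hs'
    omega

theorem walkRounds_eq_walk {f t : ℕ} (hf : t + 2 ≤ f) (u : Fin n) (next : Parents n) :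
    walkRounds w A inTree f u next t = walk w A inTree u next t := by
  induction f, hf using Nat.le_induction with
  | base => rfl
  | succ f hf ih => rw [walkRounds_succ_of_le A inTree hdraw (by omega), ih]

theorem walk_eq (u : Fin n) (next : Parents n) :
    walk w A inTree u next = (do
      runTimed w (tick)
      if inTree u then
        return next
      else
        let x ← randomNeighbor w A u
        walk w A inTree x (Function.update next u (some x))) := by
  funext t
  refine bind_apply_congr fun _ s hs => ?_
  rw [runTimed_eq_delayed] at hs
  have := add_eq_of_delayed_ne_zero hs
  split_ifs
  · rfl
  refine bind_apply_congr fun x s' hs' => walkRounds_eq_walk A inTree hdraw ?_ x _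
  have := add_draw_eq_of_randomNeighbor_ne_zero A hs'
  omega

theorem isLimitInvariant_walk (u : Fin n) (next : Parents n) :
    (walk w A inTree u next).IsLimitInvariant := by
  intro t a s
  rw [walk, isLimitInvariant_walkRounds A inTree (t + 2) u next t a s]
  split_ifs with hs
  · rw [walkRounds_eq_walk A inTree hdraw (by omega)]
  · rfl

end WalkRounds

/-- One iteration of the loop of Wilson's algorithm: a walk from `v` to the current tree, followed
by the insertion of its loop erasure. -/
noncomputable def wilsonStep (w : CostModel) (s : (Fin n → Bool) × Parents n) (v : Fin n) :
    Prog ((Fin n → Bool) × Parents n) := do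
  let next ← walk w A s.1 v s.2
  let inTree ← runTimed w (addPath next n v s.1)
  return (inTree, next)

theorem wilson_eq (w : CostModel) (r : Fin n) : wilson w A r = do
    runTimed w (tick (2 * n))
    let s ← (List.finRange n).foldlM (wilsonStep A w)
      (Function.update (fun _ => false) r true, fun _ => none)
    return s.2 :=
  rfl

theorem isLimitInvariant_wilsonStep (hdraw : 1 ≤ w.draw) (s : (Fin n → Bool) × Parents n)
    (v : Fin n) : (wilsonStep A w s v).IsLimitInvariant := by
  refine (isLimitInvariant_walk A s.1 hdraw v s.2).bind fun next => ?_
  exact (isLimitInvariant_runTimed _ _).bind fun _ => isLimitInvariant_pure _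

theorem isLimitInvariant_wilson (hdraw : 1 ≤ w.draw) (r : Fin n) :
    (wilson w A r).IsLimitInvariant :=
  (isLimitInvariant_runTimed _ _).bind fun _ =>
    (isLimitInvariant_foldlM (isLimitInvariant_wilsonStep A hdraw) _ _).bind fun _ =>
      isLimitInvariant_pure _

end Walk

/-! ### Green functions of irreducible chains -/

section Green

variable {V : Type*} [Fintype V]

/-- The transition matrix of an irreducible Markov chain. -/
structure IsIrreducibleStochastic (P : Matrix V V ℝ) : Prop extends P.IsIrreducible where
  sum_eq_one : ∀ u, ∑ v, P u v = 1

section MinPrinciple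

variable {P : Matrix V V ℝ} (hP : IsIrreducibleStochastic P) {B : Finset V} (hB : B.Nonempty)
  {X : Type*} [Finite X] (pos : X → V)

include hP hB

/-- The minimum principle is lifted along `pos`: `f` may depend on a state `s` that evolves with the
walk, provided that `s` always has a successor over every neighbour of its position. -/
theorem IsIrreducibleStochastic.nonneg_of_superharmonic {f : X → ℝ}
    (nonneg_on : ∀ s, pos s ∈ B → 0 ≤ f s)
    (superharmonic : ∀ s, pos s ∉ B → ∃ σ : V → X, (∀ y, 0 < P (pos s) y → pos (σ y) = y) ∧
      ∑ y, P (pos s) y * f (σ y) ≤ f s) (s : X) : 0 ≤ f s := by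
  obtain ⟨b, hb⟩ := hB
  have := Fintype.ofFinite X
  obtain ⟨m, -, hm⟩ := Finset.exists_min_image Finset.univ f ⟨s, Finset.mem_univ s⟩
  refine le_trans ?_ (hm s (Finset.mem_univ s))
  by_contra! hneg
  let _ : Quiver V := P.toQuiver
  have minimum_propagates : ∀ v, Quiver.Path (pos m) v → ∃ s', pos s' = v ∧ f s' = f m := by
    intro v p
    induction p with
    | nil => exact ⟨m, rfl, rfl⟩
    | @cons a c _ hac ih =>
      obtain ⟨s', rfl, hs'⟩ := ih
      obtain ⟨σ, hσ, hsum⟩ := superharmonic s' fun h => (nonneg_on s' h).not_gt (hs' ▸ hneg)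
      have hnn : ∀ y ∈ Finset.univ, 0 ≤ P (pos s') y * (f (σ y) - f m) := fun y _ =>
        mul_nonneg (hP.nonneg _ y) (sub_nonneg.2 (hm (σ y) (Finset.mem_univ _)))
      have hle : ∑ y, P (pos s') y * (f (σ y) - f m) ≤ 0 := by
        simp only [mul_sub, Finset.sum_sub_distrib]
        rw [← Finset.sum_mul, hP.sum_eq_one, one_mul, ← hs']
        linarith
      have hzero := (Finset.sum_eq_zero_iff_of_nonneg hnn).1
        (le_antisymm hle (Finset.sum_nonneg hnn)) c (Finset.mem_univ c)
      exact ⟨σ c, hσ c hac.down,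
        sub_eq_zero.1 ((mul_eq_zero.1 hzero).resolve_left hac.down.ne')⟩
  obtain ⟨p, -⟩ := hP.connected (pos m) b
  obtain ⟨s', rfl, hs'⟩ := minimum_propagates b p
  exact (nonneg_on s' hb).not_gt (hs' ▸ hneg)

theorem IsIrreducibleStochastic.eq_of_sub_eq_of_lift {f g : X → ℝ}
    (eq_on : ∀ s, pos s ∈ B → f s = g s)
    (sub_eq : ∀ s, pos s ∉ B → ∃ σ : V → X, (∀ y, 0 < P (pos s) y → pos (σ y) = y) ∧
      f s - ∑ y, P (pos s) y * f (σ y) = g s - ∑ y, P (pos s) y * g (σ y)) (s : X) :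
    f s = g s := by
  refine le_antisymm (sub_nonneg.1 ?_) (sub_nonneg.1 ?_)
  · refine hP.nonneg_of_superharmonic hB pos (f := fun s => g s - f s)
      (fun s hs => (sub_eq_zero.2 (eq_on s hs).symm).ge) (fun s hs => ?_) s
    obtain ⟨σ, hσ, h⟩ := sub_eq s hs
    refine ⟨σ, hσ, ?_⟩
    simp only [mul_sub, Finset.sum_sub_distrib]
    linarith
  · refine hP.nonneg_of_superharmonic hB pos (f := fun s => f s - g s)
      (fun s hs => (sub_eq_zero.2 (eq_on s hs)).ge) (fun s hs => ?_) s
    obtain ⟨σ, hσ, h⟩ := sub_eq s hs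
    refine ⟨σ, hσ, ?_⟩
    simp only [mul_sub, Finset.sum_sub_distrib]
    linarith

theorem IsIrreducibleStochastic.eq_of_sub_eq {f g : V → ℝ} (eq_on : ∀ u ∈ B, f u = g u)
    (sub_eq : ∀ u, u ∉ B → f u - ∑ y, P u y * f y = g u - ∑ y, P u y * g y) (u : V) :
    f u = g u :=
  hP.eq_of_sub_eq_of_lift hB id eq_on (fun u hu => ⟨id, fun _ _ => rfl, sub_eq u hu⟩) u

end MinPrinciple

variable [DecidableEq V]

/-- `I - P` with the rows of `P` in `B` replaced by zero: the generator of the chain stopped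
at `B`. -/
def stoppedLaplacian (P : Matrix V V ℝ) (B : Finset V) : Matrix V V ℝ :=
  1 - Matrix.of fun u v => if u ∈ B then 0 else P u v

/-- The Green function of the chain stopped at `B`. For `z ∉ B` the entry at `(u, z)` is the
expected number of visits to `z` of the chain started at `u` before it hits `B`; for `z ∈ B` it is
the probability that `B` is hit at `z`. -/
noncomputable def green (P : Matrix V V ℝ) (B : Finset V) : Matrix V V ℝ :=
  (stoppedLaplacian P B)⁻¹

/-- The expected time at which the chain started at `u` hits `B`. -/
noncomputable def hitTime (P : Matrix V V ℝ) (B : Finset V) (u : V) : ℝ := ∑ x ∈ Bᶜ, green P B u x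

/-- The trace of the Green function outside `B`. -/
noncomputable def greenTrace (P : Matrix V V ℝ) (B : Finset V) : ℝ := ∑ x ∈ Bᶜ, green P B x x

theorem stoppedLaplacian_mulVec (P : Matrix V V ℝ) (B : Finset V) (f : V → ℝ) (u : V) :
    (stoppedLaplacian P B).mulVec f u = f u - if u ∈ B then 0 else ∑ y, P u y * f y := by
  rw [stoppedLaplacian, Matrix.sub_mulVec, Matrix.one_mulVec, Pi.sub_apply]
  congr 1
  simp only [Matrix.mulVec, dotProduct, Matrix.of_apply]
  split_ifs <;> simp

namespace IsIrreducibleStochastic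

variable {P : Matrix V V ℝ} {B : Finset V} (hP : IsIrreducibleStochastic P)
include hP

theorem isUnit_stoppedLaplacian (hB : B.Nonempty) : IsUnit (stoppedLaplacian P B) := by
  refine Matrix.mulVec_injective_iff_isUnit.1 fun f g hfg => funext fun u => ?_
  have mulVec_eq : ∀ u, (stoppedLaplacian P B).mulVec f u = (stoppedLaplacian P B).mulVec g u :=
    congrFun hfg
  simp only [stoppedLaplacian_mulVec] at mulVec_eq
  refine hP.eq_of_sub_eq hB (fun u hu => ?_) (fun u hu => ?_) u
  · simpa [hu] using mulVec_eq u
  · simpa [hu] using mulVec_eq u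

theorem stoppedLaplacian_mul_green (hB : B.Nonempty) (u z : V) :
    green P B u z - (if u ∈ B then 0 else ∑ y, P u y * green P B y z) =
      if u = z then 1 else 0 := by
  have mul_inv := Matrix.mul_nonsing_inv _
    ((Matrix.isUnit_iff_isUnit_det _).1 (hP.isUnit_stoppedLaplacian hB))
  rw [← Matrix.one_apply, ← mul_inv]
  exact (stoppedLaplacian_mulVec P B (fun y => green P B y z) u).symm

theorem green_of_mem {u : V} (hu : u ∈ B) (z : V) : green P B u z = if u = z then 1 else 0 := by
  simpa [hu] using hP.stoppedLaplacian_mul_green ⟨u, hu⟩ u z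

theorem green_eq_zero {u z : V} (hu : u ∈ B) (huz : u ≠ z) : green P B u z = 0 := by
  rw [hP.green_of_mem hu, if_neg huz]

theorem green_of_notMem (hB : B.Nonempty) {u : V} (hu : u ∉ B) (z : V) :
    green P B u z = (if u = z then 1 else 0) + ∑ y, P u y * green P B y z := by
  have := hP.stoppedLaplacian_mul_green hB u z
  rw [if_neg hu] at this
  linarith

theorem green_nonneg (hB : B.Nonempty) (u z : V) : 0 ≤ green P B u z := by
  refine hP.nonneg_of_superharmonic hB id (f := fun u => green P B u z)
    (fun u (hu : u ∈ B) => ?_) (fun u (hu : u ∉ B) => ⟨id, fun _ _ => rfl, ?_⟩) u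
  · rw [hP.green_of_mem hu]
    split_ifs <;> norm_num
  · change ∑ y, P u y * green P B y z ≤ green P B u z
    rw [hP.green_of_notMem hB hu]
    exact le_add_of_nonneg_left (by split_ifs <;> norm_num)

theorem one_le_green_self (hB : B.Nonempty) (u : V) : 1 ≤ green P B u u := by
  by_cases hu : u ∈ B
  · simp [hP.green_of_mem hu]
  · rw [hP.green_of_notMem hB hu, if_pos rfl, le_add_iff_nonneg_right]
    exact Finset.sum_nonneg fun y _ => mul_nonneg (hP.nonneg u y) (hP.green_nonneg hB y u)

theorem sum_green_boundary (hB : B.Nonempty) (u : V) : ∑ z ∈ B, green P B u z = 1 := by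
  refine hP.eq_of_sub_eq hB (f := fun u => ∑ z ∈ B, green P B u z) (g := fun _ => 1)
    (fun u hu => ?_) (fun u hu => ?_) u
  · simp only [hP.green_of_mem hu, Finset.sum_ite_eq, hu, if_true]
  · simp only [mul_one, hP.sum_eq_one, sub_self, Finset.mul_sum]
    rw [Finset.sum_comm, ← Finset.sum_sub_distrib]
    refine Finset.sum_eq_zero fun z hz => ?_
    rw [hP.green_of_notMem hB hu, if_neg (ne_of_mem_of_not_mem hz hu).symm]
    ring

theorem green_insert_mul (hB : B.Nonempty) {u : V} (hu : u ∉ B) (y : V) :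
    green P B y u = green P (insert u B) y u * green P B u u := by
  have hI := Finset.insert_nonempty u B
  refine hP.eq_of_sub_eq hI (f := fun y => green P B y u)
    (g := fun y => green P (insert u B) y u * green P B u u) (fun y hy => ?_) (fun y hy => ?_) y
  · rw [hP.green_of_mem hy]
    rcases Finset.mem_insert.1 hy with rfl | hy
    · rw [if_pos rfl, one_mul]
    · have hyu := ne_of_mem_of_not_mem hy hu
      rw [hP.green_eq_zero hy hyu, if_neg hyu, zero_mul]
  · rw [hP.green_of_notMem hI hy]
    rw [Finset.mem_insert, not_or] at hy
    rw [hP.green_of_notMem hB hy.2, if_neg hy.1]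
    simp only [zero_add, Finset.sum_mul, mul_assoc, sub_self]

theorem green_eq_insert_add (hB : B.Nonempty) {u z : V} (hu : u ∉ B) (hz : z ≠ u) (y : V) :
    green P B y z = green P (insert u B) y z + green P (insert u B) y u * green P B u z := by
  have hI := Finset.insert_nonempty u B
  refine hP.eq_of_sub_eq hI (f := fun y => green P B y z)
    (g := fun y => green P (insert u B) y z + green P (insert u B) y u * green P B u z)
    (fun y hy => ?_) (fun y hy => ?_) y
  · rw [hP.green_of_mem hy, hP.green_of_mem hy]
    rcases Finset.mem_insert.1 hy with rfl | hy
    · simp [hz.symm]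
    · rw [hP.green_of_mem hy, if_neg (ne_of_mem_of_not_mem hy hu)]
      ring
  · rw [hP.green_of_notMem hI hy, hP.green_of_notMem hI hy]
    rw [Finset.mem_insert, not_or] at hy
    rw [hP.green_of_notMem hB hy.2, if_neg hy.1]
    simp only [mul_add, Finset.sum_add_distrib, ← mul_assoc, ← Finset.sum_mul]
    ring

theorem green_self_mul_escape (hB : B.Nonempty) {u : V} (hu : u ∉ B) :
    green P B u u * (1 - ∑ y, P u y * green P (insert u B) y u) = 1 := by
  have first_step := hP.green_of_notMem hB hu u
  rw [if_pos rfl, Finset.sum_congr rfl fun y _ => by rw [hP.green_insert_mul hB hu y]] at first_step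
  simp only [← mul_assoc, ← Finset.sum_mul] at first_step
  linarith

theorem green_eq_mul_sum (hB : B.Nonempty) {u z : V} (hu : u ∉ B) (hz : z ≠ u) :
    green P B u z = green P B u u * ∑ y, P u y * green P (insert u B) y z := by
  have first_step := hP.green_of_notMem hB hu z
  rw [if_neg hz.symm, Finset.sum_congr rfl fun y _ => by
    rw [hP.green_eq_insert_add hB hu hz y]] at first_step
  simp only [mul_add, Finset.sum_add_distrib, ← mul_assoc, ← Finset.sum_mul, zero_add]
    at first_step
  have escape := hP.green_self_mul_escape hB hu
  linear_combination green P B u u * first_step - green P B u z * escape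

theorem green_mul_green_insert (hB : B.Nonempty) {u x : V} (hu : u ∉ B) (hx : x ∉ B)
    (hux : x ≠ u) :
    green P B x x * green P (insert x B) u u = green P B u u * green P (insert u B) x x := by
  linear_combination green P B u u * hP.green_eq_insert_add hB hu hux x -
    green P B x x * hP.green_eq_insert_add hB hx hux.symm u +
    green P B x u * hP.green_insert_mul hB hx u - green P B u x * hP.green_insert_mul hB hu x

theorem hitTime_of_mem {u : V} (hu : u ∈ B) : hitTime P B u = 0 :=
  Finset.sum_eq_zero fun _ hx =>
    hP.green_eq_zero hu (ne_of_mem_of_not_mem hu (Finset.mem_compl.1 hx))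

theorem hitTime_of_notMem (hB : B.Nonempty) {u : V} (hu : u ∉ B) :
    hitTime P B u = 1 + ∑ y, P u y * hitTime P B y := by
  simp only [hitTime, Finset.mul_sum]
  rw [Finset.sum_comm, Finset.sum_congr rfl fun x _ => hP.green_of_notMem hB hu x,
    Finset.sum_add_distrib]
  simp [hu]

theorem hitTime_nonneg (hB : B.Nonempty) (u : V) : 0 ≤ hitTime P B u :=
  Finset.sum_nonneg fun x _ => hP.green_nonneg hB u x

theorem greenTrace_nonneg (hB : B.Nonempty) : 0 ≤ greenTrace P B :=
  Finset.sum_nonneg fun x _ => hP.green_nonneg hB x x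

end IsIrreducibleStochastic

end Green

/-! ### The Green function along a loop erasure -/

section LoopErasure

variable {V : Type*} [Fintype V] [DecidableEq V]

/-- The Green function at `(x, x)` of the chain stopped at `B`, times the probability that the
chain started at `u` hits `B ∪ {x}` in `S`. -/
noncomputable def escapeGreen (P : Matrix V V ℝ) (S : Finset V) (x : V) (B : Finset V) (u : V) :
    ℝ :=
  if x ∈ B then 0 else green P B x x * ∑ z ∈ S, green P (insert x B) u z

/-- Let `β` be the current loop-erased path, in reverse order. This is the expectation of
the Green function at `(x, x)` of the chain stopped at `S` and the final loop-erased path, over the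
event that the chain started at `y` returns to `β` before it hits `S`. -/
noncomputable def returnGreen (P : Matrix V V ℝ) (S : Finset V) (x : V) : List V → V → ℝ
  | [], _ => 0
  | a :: β, y => returnGreen P S x β y +
      green P (insert a (S ∪ β.toFinset)) y a * escapeGreen P S x (S ∪ β.toFinset) a

/-- The expectation of the Green function at `(x, x)` of the chain stopped at `S` and the final
loop-erased path, when the current loop-erased path consists of `β`, in reverse order, and `u`. -/
noncomputable def erasedGreen (P : Matrix V V ℝ) (S : Finset V) (x : V) (β : List V) (u : V) : ℝ :=
  returnGreen P S x β u + escapeGreen P S x (S ∪ β.toFinset) u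

/-- The expected number of steps which are still to be made in Wilson's algorithm when the tree
is `S` and the current loop-erased path consists of `β`, in reverse order, and `u`. -/
noncomputable def remainingSteps (P : Matrix V V ℝ) (S : Finset V) (β : List V) (u : V) : ℝ :=
  hitTime P S u + ∑ x ∈ Sᶜ, erasedGreen P S x β u

namespace IsIrreducibleStochastic

variable {P : Matrix V V ℝ} {S : Finset V} (hP : IsIrreducibleStochastic P) (hS : S.Nonempty)
  (x : V)

include hP

theorem returnGreen_of_mem {β : List V} (hβ : ∀ a ∈ β, a ∉ S) {y : V} (hy : y ∈ S) :
    returnGreen P S x β y = 0 := by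
  induction β with
  | nil => rfl
  | cons a β ih =>
    rw [returnGreen, ih fun b hb => hβ b (List.mem_cons_of_mem a hb),
      hP.green_eq_zero (by simp [hy]) (ne_of_mem_of_not_mem hy (hβ a List.mem_cons_self)),
      zero_mul, zero_add]

theorem returnGreen_of_notMem {β : List V} {y : V} (hy : y ∉ S) (hyβ : y ∉ β) :
    returnGreen P S x β y = ∑ z, P y z * returnGreen P S x β z := by
  induction β with
  | nil => simp [returnGreen]
  | cons a β ih =>
    rw [List.mem_cons, not_or] at hyβ
    simp only [returnGreen, mul_add, Finset.sum_add_distrib]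
    rw [← ih hyβ.2, hP.green_of_notMem (Finset.insert_nonempty _ _) (by simp [hyβ, hy]),
      if_neg hyβ.1, zero_add, Finset.sum_mul]
    simp only [mul_assoc]

theorem returnGreen_append (pre β : List V) {y : V} (hnd : (pre ++ y :: β).Nodup) :
    returnGreen P S x (pre ++ y :: β) y =
      returnGreen P S x β y + escapeGreen P S x (S ∪ β.toFinset) y := by
  induction pre with
  | nil => rw [List.nil_append, returnGreen, hP.green_of_mem (by simp), if_pos rfl, one_mul]
  | cons a pre ih =>
    rw [List.cons_append, List.nodup_cons] at hnd
    have hya : y ≠ a := ne_of_mem_of_not_mem (by simp) hnd.1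
    rw [List.cons_append, returnGreen, ih hnd.2, hP.green_eq_zero (by simp) hya, zero_mul, add_zero]

theorem escapeGreen_of_mem {B : Finset V} {y : V} (hy : y ∈ B) (hyS : y ∉ S) :
    escapeGreen P S x B y = 0 := by
  rw [escapeGreen, Finset.sum_eq_zero, mul_zero, ite_self]
  exact fun z hz =>
    hP.green_eq_zero (Finset.mem_insert_of_mem hy) (ne_of_mem_of_not_mem hz hyS).symm

include hS in
theorem escapeGreen_mul_escape {B : Finset V} (hSB : S ⊆ B) {u : V} (hu : u ∉ B) :
    escapeGreen P S x B u * (1 - ∑ y, P u y * green P (insert u B) y u) =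
      ∑ y, P u y * escapeGreen P S x (insert u B) y := by
  by_cases hx : x ∈ B
  · simp [escapeGreen, hx]
  obtain rfl | hux := eq_or_ne x u
  · have hzero : ∑ z ∈ S, green P (insert x B) x z = 0 := Finset.sum_eq_zero fun z hz =>
      hP.green_eq_zero (Finset.mem_insert_self x B) (ne_of_mem_of_not_mem (hSB hz) hu).symm
    simp [escapeGreen, hzero]
  have hux' : u ∉ insert x B := by simp [hu, hux.symm]
  have first_step : ∀ z ∈ S, green P (insert x B) u z = green P (insert x B) u u *
      ∑ y, P u y * green P (insert x (insert u B)) y z := fun z hz => by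
    rw [hP.green_eq_mul_sum (Finset.insert_nonempty _ _) hux' (ne_of_mem_of_not_mem (hSB hz) hu),
      Finset.insert_comm]
  have sum_escapeGreen : ∑ y, P u y * escapeGreen P S x (insert u B) y =
      green P (insert u B) x x *
        ∑ z ∈ S, ∑ y, P u y * green P (insert x (insert u B)) y z := by
    simp only [escapeGreen, Finset.mem_insert, hux, hx, or_self, if_false, Finset.mul_sum]
    rw [Finset.sum_comm]
    exact Finset.sum_congr rfl fun _ _ => Finset.sum_congr rfl fun _ _ => mul_left_comm _ _ _
  rw [sum_escapeGreen, escapeGreen, if_neg hx, Finset.sum_congr rfl first_step, ← Finset.mul_sum]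
  have swap := hP.green_mul_green_insert (hS.mono hSB) hu hx hux
  have escape := hP.green_self_mul_escape (hS.mono hSB) hu
  generalize ∑ z ∈ S, ∑ y, P u y * green P (insert x (insert u B)) y z = R
  linear_combination (R * (1 - ∑ y, P u y * green P (insert u B) y u)) * swap +
    (R * green P (insert u B) x x) * escape

include hS in
theorem erasedGreen_step {β : List V} {u : V} (huS : u ∉ S) (huβ : u ∉ β) :
    erasedGreen P S x β u = ∑ y, P u y * erasedGreen P S x (u :: β) y := by
  have hins : S ∪ (u :: β).toFinset = insert u (S ∪ β.toFinset) := by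
    rw [List.toFinset_cons, Finset.union_insert]
  have hu : u ∉ S ∪ β.toFinset := by simp [huS, huβ]
  have escape := hP.escapeGreen_mul_escape hS x Finset.subset_union_left hu
  simp only [erasedGreen, returnGreen, hins, mul_add, Finset.sum_add_distrib, ← mul_assoc,
    ← Finset.sum_mul]
  linarith [hP.returnGreen_of_notMem x huS huβ]

theorem erasedGreen_append (pre β : List V) {y : V} (hnd : (pre ++ y :: β).Nodup) (hy : y ∉ S) :
    erasedGreen P S x (pre ++ y :: β) y = erasedGreen P S x β y := by
  rw [erasedGreen, hP.returnGreen_append x pre β hnd,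
    hP.escapeGreen_of_mem x (B := S ∪ (pre ++ y :: β).toFinset) (by simp) hy, add_zero, erasedGreen]

include hS in
theorem erasedGreen_nil {x : V} (hx : x ∉ S) (v : V) :
    erasedGreen P S x [] v = green P S x x - green P S v x := by
  have total := hP.sum_green_boundary (Finset.insert_nonempty x S) v
  rw [Finset.sum_insert hx] at total
  simp only [erasedGreen, returnGreen, escapeGreen, List.toFinset_nil, Finset.union_empty, hx,
    if_false]
  linear_combination (green P S x x) * total + hP.green_insert_mul hS hx v

theorem erasedGreen_of_mem {β : List V} (hβ : ∀ a ∈ β, a ∉ S) {u : V} (hu : u ∈ S) :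
    erasedGreen P S x β u =
      if x ∈ S ∪ β.toFinset then 0 else green P (S ∪ β.toFinset) x x := by
  rw [erasedGreen, hP.returnGreen_of_mem x hβ hu, escapeGreen, zero_add,
    Finset.sum_congr rfl fun z _ => hP.green_of_mem (by simp [hu]) z, Finset.sum_ite_eq,
    if_pos hu, mul_one]

include hS in
theorem remainingSteps_step {β : List V} {u : V} (huS : u ∉ S) (huβ : u ∉ β) :
    remainingSteps P S β u = 1 + ∑ y, P u y * remainingSteps P S (u :: β) y := by
  simp only [remainingSteps, mul_add, Finset.sum_add_distrib, Finset.mul_sum]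
  rw [hP.hitTime_of_notMem hS huS, Finset.sum_comm (s := Finset.univ),
    Finset.sum_congr rfl fun x _ => hP.erasedGreen_step hS x huS huβ, add_assoc]

theorem remainingSteps_append (pre β : List V) {y : V} (hnd : (pre ++ y :: β).Nodup)
    (hy : y ∉ S) : remainingSteps P S (pre ++ y :: β) y = remainingSteps P S β y := by
  rw [remainingSteps, Finset.sum_congr rfl fun x _ => hP.erasedGreen_append x pre β hnd hy,
    remainingSteps]

include hS in
theorem remainingSteps_nil (v : V) : remainingSteps P S [] v = greenTrace P S := by
  rw [remainingSteps, Finset.sum_congr rfl fun x hx =>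
    hP.erasedGreen_nil hS (Finset.mem_compl.1 hx) v, Finset.sum_sub_distrib, hitTime, greenTrace]
  ring

theorem remainingSteps_of_mem {β : List V} (hβ : ∀ a ∈ β, a ∉ S) {u : V} (hu : u ∈ S) :
    remainingSteps P S β u = greenTrace P (S ∪ β.toFinset) := by
  rw [remainingSteps, hP.hitTime_of_mem hu, zero_add,
    Finset.sum_congr rfl fun x _ => hP.erasedGreen_of_mem x hβ hu, greenTrace, Finset.compl_union]
  simp only [← ite_not (_ ∈ _), ← Finset.sum_filter]
  congr 1
  ext x
  simp

theorem escapeGreen_nonneg {B : Finset V} (hB : B.Nonempty) (u : V) :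
    0 ≤ escapeGreen P S x B u := by
  rw [escapeGreen]
  split_ifs
  · exact le_rfl
  · exact mul_nonneg (hP.green_nonneg hB x x)
      (Finset.sum_nonneg fun z _ => hP.green_nonneg (Finset.insert_nonempty x B) u z)

include hS in
theorem returnGreen_nonneg (β : List V) (y : V) : 0 ≤ returnGreen P S x β y := by
  induction β with
  | nil => exact le_rfl
  | cons a β ih =>
    exact add_nonneg ih (mul_nonneg (hP.green_nonneg (Finset.insert_nonempty _ _) y a)
      (hP.escapeGreen_nonneg x (hS.mono Finset.subset_union_left) a))

include hS in
theorem remainingSteps_nonneg (β : List V) (u : V) : 0 ≤ remainingSteps P S β u :=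
  add_nonneg (hP.hitTime_nonneg hS u) (Finset.sum_nonneg fun x _ =>
    add_nonneg (hP.returnGreen_nonneg hS x β u)
      (hP.escapeGreen_nonneg x (hS.mono Finset.subset_union_left) u))

end IsIrreducibleStochastic

end LoopErasure

/-! ### Loop-erased paths -/

section LoopErased

variable {n : ℕ} {G : SimpleGraph (Fin n)} {S : Fin n → Bool} {v u y : Fin n} {next : Parents n}
  {β : List (Fin n)}

/-- The set of vertices of the tree that is recorded by the flags `S`. -/
def treeSet (S : Fin n → Bool) : Finset (Fin n) := Finset.univ.filter fun x => S x = true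

/-- The flags of the tree `S` after the vertices of `β` have been added. -/
def addList (S : Fin n → Bool) (β : List (Fin n)) : Fin n → Bool := fun x => S x || decide (x ∈ β)

theorem mem_treeSet : u ∈ treeSet S ↔ S u = true := by
  simp [treeSet]

theorem notMem_treeSet : u ∉ treeSet S ↔ S u = false := by
  simp [treeSet]

theorem treeSet_addList (S : Fin n → Bool) (β : List (Fin n)) :
    treeSet (addList S β) = treeSet S ∪ β.toFinset := by
  ext x
  simp [treeSet, addList]

theorem addList_nil (S : Fin n → Bool) : addList S [] = S := by
  funext x
  simp [addList]

theorem addList_update (S : Fin n → Bool) (u : Fin n) (β : List (Fin n)) :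
    addList (Function.update S u true) β = addList S (u :: β) := by
  funext x
  by_cases hx : x = u <;> simp [addList, hx]

theorem addList_cons_of_mem (hu : S u = true) (β : List (Fin n)) :
    addList S (u :: β) = addList S β := by
  rw [← addList_update, Function.update_eq_self_iff.2 hu.symm]

theorem addPath_eq (γ : List (Fin n)) {f : ℕ} (hf : γ.length < f)
    (hchain : (v :: γ).IsChain fun a b => next a = some b) (hnd : (v :: γ).Nodup)
    (hlast : S ((v :: γ).getLast (List.cons_ne_nil v γ)) = true)
    (hnotMem : ∀ a ∈ (v :: γ).dropLast, S a = false) :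
    addPath next f v S = ⟨addList S (v :: γ), γ.length + 1⟩ := by
  induction γ generalizing S f v with
  | nil =>
    obtain ⟨f, rfl⟩ := Nat.exists_eq_add_of_lt hf
    rw [List.getLast_singleton] at hlast
    rw [addPath, if_pos hlast, addList_cons_of_mem hlast, addList_nil]
    rfl
  | cons x γ ih =>
    obtain ⟨f, rfl⟩ := Nat.exists_eq_add_of_lt hf
    rw [List.isChain_cons_cons] at hchain
    rw [List.nodup_cons] at hnd
    rw [List.dropLast_cons_cons, List.forall_mem_cons] at hnotMem
    rw [List.getLast_cons_cons] at hlast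
    have rest := ih (S := Function.update S v true) (f := (x :: γ).length + f)
      (by rw [List.length_cons]; omega) hchain.2 hnd.2
      (Function.update_apply S v true _ ▸ by split_ifs <;> trivial)
      (fun a ha => by
        rw [Function.update_of_ne (ne_of_mem_of_not_mem (List.mem_of_mem_dropLast ha) hnd.1)]
        exact hnotMem.2 a ha)
    rw [addPath, if_neg (by simp [hnotMem.1]), hchain.1]
    simp only [rest]
    rw [addList_update, List.length_cons, add_comm (γ.length + 1) 1]
    rfl

/-- The walk started at `v` is at `u`, it has not met the tree `S` before, and its current loop
erasure, as recorded by `next`, consists of `β`, in reverse order, and `u`. -/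
structure LoopErased (G : SimpleGraph (Fin n)) (S : Fin n → Bool) (v : Fin n) (next : Parents n)
    (β : List (Fin n)) (u : Fin n) : Prop where
  chain : (u :: β).IsChain fun a b => next b = some a ∧ G.Adj b a
  nodup : (u :: β).Nodup
  notMem : ∀ a ∈ β, S a = false
  start : (u :: β).getLast? = some v

namespace LoopErased

theorem nil (S : Fin n → Bool) (v : Fin n) (next : Parents n) : LoopErased G S v next [] v :=
  ⟨List.isChain_singleton v, List.nodup_singleton v, List.forall_mem_nil _, rfl⟩

variable (h : LoopErased G S v next β u)
include h

theorem notMem_path : u ∉ β := (List.nodup_cons.1 h.nodup).1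

theorem nodup_path : β.Nodup := (List.nodup_cons.1 h.nodup).2

theorem length_lt : β.length < n := by
  simpa using h.nodup.length_le_card

theorem addPath_eq (hu : S u = true) : addPath next n v S = ⟨addList S β, β.length + 1⟩ := by
  obtain ⟨δ, hδ⟩ := List.getLast?_eq_some_iff.1 h.start
  have hrev : v :: δ.reverse = (u :: β).reverse := by rw [hδ, List.reverse_concat]
  have hlength : δ.length = β.length := by
    simpa using congrArg List.length hδ.symm
  rw [KemenyTTF.addPath_eq δ.reverse (by rw [List.length_reverse, hlength]; exact h.length_lt),
    List.length_reverse, hlength, hrev]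
  · have reverse_path : addList S (u :: β).reverse = addList S (u :: β) := by
      funext x
      simp only [addList, List.mem_reverse]
    rw [reverse_path, addList_cons_of_mem hu]
  · rw [hrev, List.isChain_reverse]
    exact h.chain.imp fun a b hab => hab.1
  · rw [hrev]
    exact List.nodup_reverse.2 h.nodup
  · simpa [hrev] using hu
  · rw [hrev, List.dropLast_reverse]
    exact fun a ha => h.notMem a (List.mem_reverse.1 ha)

theorem start_mem_addList (hu : S u = true) : addList S β v = true := by
  rw [← addList_cons_of_mem hu]
  simp [addList, List.mem_of_getLast? h.start]

theorem mem_of_addList_eq_false (hu : S u = true) {l : List (Fin n)}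
    (hl : ∀ x, S x = false → x ∈ v :: l) (x : Fin n) (hx : addList S β x = false) : x ∈ l := by
  refine (List.mem_cons.1 (hl x (Bool.or_eq_false_iff.1 hx).1)).resolve_left ?_
  rintro rfl
  simp [h.start_mem_addList hu] at hx

theorem card_compl_treeSet :
    (treeSet S)ᶜ.card = (treeSet (addList S β))ᶜ.card + β.length := by
  have hsub : β.toFinset ⊆ (treeSet S)ᶜ := fun a ha =>
    Finset.mem_compl.2 (notMem_treeSet.2 (h.notMem a (List.mem_toFinset.1 ha)))
  rw [treeSet_addList, ← List.toFinset_card_of_nodup h.nodup_path, Finset.compl_union,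
    ← Finset.sdiff_eq_inter_compl, Finset.card_sdiff_add_card_eq_card hsub]

theorem step (hu : S u = false) (hy : G.Adj u y) :
    ∃ β', LoopErased G S v (Function.update next u (some y)) β' y ∧
      (β' = u :: β ∨ ∃ pre, u :: β = pre ++ y :: β') := by
  have hchain : (u :: β).IsChain fun a b =>
      Function.update next u (some y) b = some a ∧ G.Adj b a :=
    h.chain.imp_of_mem_tail_imp fun a b _ hb hab => by
      rwa [Function.update_of_ne (ne_of_mem_of_not_mem hb h.notMem_path)]
  have hnotMem : ∀ a ∈ u :: β, S a = false := List.forall_mem_cons.2 ⟨hu, h.notMem⟩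
  by_cases hyβ : y ∈ u :: β
  · obtain ⟨pre, β', hsplit⟩ := List.append_of_mem hyβ
    have hnd := h.nodup
    have hstart := h.start
    rw [hsplit] at hchain hnd hstart hnotMem
    refine ⟨β', ⟨hchain.right_of_append, (List.nodup_append.1 hnd).2.1,
      fun a ha => hnotMem a (by simp [ha]), ?_⟩, Or.inr ⟨pre, hsplit⟩⟩
    rw [List.getLast?_append] at hstart
    rw [← hstart, List.getLast?_cons]
    rfl
  · refine ⟨u :: β, ⟨List.isChain_cons_cons.2 ⟨⟨by simp, hy⟩, hchain⟩,
      List.nodup_cons.2 ⟨hyβ, h.nodup⟩, hnotMem, ?_⟩, Or.inl rfl⟩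
    rw [List.getLast?_cons_cons]
    exact h.start

end LoopErased

/-- A state of the walk started at `v` that is run until it hits the tree `S`. -/
structure WalkState (G : SimpleGraph (Fin n)) (S : Fin n → Bool) (v : Fin n) where
  /-- the current vertex -/
  pos : Fin n
  /-- the array of last exits -/
  next : Parents n
  /-- the loop-erased path up to the current vertex, in reverse order -/
  path : List (Fin n)
  loopErased : LoopErased G S v next path pos

instance (S : Fin n → Bool) (v : Fin n) : Finite (WalkState G S v) := by
  refine Finite.of_injective (β := Fin n × Parents n × {l : List (Fin n) // l.Nodup})
    (fun s => (s.pos, s.next, ⟨s.path, s.loopErased.nodup_path⟩)) ?_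
  rintro ⟨u, next, β, _⟩ ⟨u', next', β', _⟩ heq
  simpa only [Prod.mk.injEq, Subtype.mk.injEq, WalkState.mk.injEq] using heq

theorem WalkState.exists_step (s : WalkState G S v) (hs : S s.pos = false) :
    ∃ σ : Fin n → WalkState G S v, ∀ y, G.Adj s.pos y → (σ y).pos = y ∧
      (σ y).next = Function.update s.next s.pos (some y) ∧
      ((σ y).path = s.pos :: s.path ∨ ∃ pre, s.pos :: s.path = pre ++ y :: (σ y).path) := by
  have exists_next (y : Fin n) : ∃ s' : WalkState G S v, G.Adj s.pos y → s'.pos = y ∧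
      s'.next = Function.update s.next s.pos (some y) ∧
      (s'.path = s.pos :: s.path ∨ ∃ pre, s.pos :: s.path = pre ++ y :: s'.path) := by
    by_cases hy : G.Adj s.pos y
    · obtain ⟨β', h', hβ'⟩ := s.loopErased.step hs hy
      exact ⟨⟨y, _, β', h'⟩, fun _ => ⟨rfl, rfl, hβ'⟩⟩
    · exact ⟨s, fun h => absurd h hy⟩
  choose σ hσ using exists_next
  exact ⟨σ, hσ⟩

end LoopErased

/-! ### The random walk and the Laplacian minor -/

section Minor

variable {n : ℕ} {G : SimpleGraph (Fin n)} [DecidableRel G.Adj]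

theorem degree_ne_zero (hn : 2 ≤ n) (hG : G.Connected) (u : Fin n) : G.degree u ≠ 0 :=
  have := Fin.nontrivial_iff_two_le.2 hn
  (hG.preconnected.degree_pos_of_nontrivial u).ne'

theorem isIrreducibleStochastic_transitionMatrix (hn : 2 ≤ n) (hG : G.Connected) :
    IsIrreducibleStochastic (transitionMatrix G) := by
  have hd := degree_ne_zero hn hG
  refine ⟨⟨transitionMatrix_nonneg hd, fun u v => ?_⟩, sum_transitionMatrix hd⟩
  let _ : Quiver (Fin n) := (transitionMatrix G).toQuiver
  have edge {a b : Fin n} (h : G.Adj a b) : a ⟶ b := PLift.up ((transitionMatrix_pos_iff hd).2 h)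
  have path_of_walk : ∀ {a b : Fin n}, G.Walk a b → Nonempty (Quiver.Path a b) := by
    intro a b p
    induction p with
    | nil => exact ⟨Quiver.Path.nil⟩
    | cons hadj _ ih =>
      exact ih.map ((edge hadj).toPath.comp ·)
  obtain ⟨x, hx⟩ := (G.degree_pos_iff_exists_adj u).1 (Nat.pos_of_ne_zero (hd u))
  obtain ⟨p⟩ := path_of_walk (hG.preconnected x v).some
  refine ⟨(edge hx).toPath.comp p, ?_⟩
  rw [Quiver.Path.length_comp, Quiver.Path.length_toPath]
  omega

variable (hP : IsIrreducibleStochastic (transitionMatrix G))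
include hP

theorem laplacianMinor_mul_green (r : Fin n) :
    laplacianMinor G r *
      (green (transitionMatrix G) {r}).submatrix Subtype.val Subtype.val = 1 := by
  ext u z
  have hu : (u : Fin n) ∉ ({r} : Finset (Fin n)) := by simpa using u.2
  have sum_restrict : ∑ y : {v : Fin n // v ≠ r}, transitionMatrix G u y *
      green (transitionMatrix G) {r} y z = ∑ y, transitionMatrix G u y *
        green (transitionMatrix G) {r} y z := by
    rw [← Finset.add_sum_erase _ _ (Finset.mem_univ r),
      hP.green_eq_zero (Finset.mem_singleton_self r) z.2.symm, mul_zero, zero_add]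
    exact (Finset.sum_subtype (p := fun v => v ≠ r) (Finset.univ.erase r) (fun v => by simp)
      fun y => transitionMatrix G u y * green (transitionMatrix G) {r} y z).symm
  have first_step := hP.green_of_notMem (Finset.singleton_nonempty r) hu z
  rw [laplacianMinor, sub_mul, one_mul, Matrix.sub_apply, Matrix.mul_apply]
  simp only [Matrix.submatrix_apply]
  rw [sum_restrict, first_step, Matrix.one_apply, add_sub_cancel_right]
  simp only [Subtype.ext_iff]

theorem isUnit_laplacianMinor (r : Fin n) : IsUnit (laplacianMinor G r) :=
  IsUnit.of_mul_eq_one _ (laplacianMinor_mul_green hP r)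

theorem trace_inv_laplacianMinor (r : Fin n) :
    (laplacianMinor G r)⁻¹.trace = greenTrace (transitionMatrix G) {r} := by
  rw [Matrix.inv_eq_right_inv (laplacianMinor_mul_green hP r), greenTrace, Matrix.trace]
  exact (Finset.sum_subtype (p := fun v => v ≠ r) _ (fun x => by simp)
    fun x => green (transitionMatrix G) {r} x x).symm

theorem card_sub_one_le_trace (r : Fin n) : (n : ℝ) - 1 ≤ (laplacianMinor G r)⁻¹.trace := by
  rw [trace_inv_laplacianMinor hP, greenTrace]
  calc (n : ℝ) - 1 = (({r} : Finset (Fin n))ᶜ.card : ℝ) := by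
        rw [Finset.card_compl, Finset.card_singleton, Fintype.card_fin, Nat.cast_pred (Fin.pos r)]
    _ ≤ ∑ x ∈ ({r} : Finset (Fin n))ᶜ, green (transitionMatrix G) {r} x x := by
        rw [← nsmul_one, ← Finset.sum_const]
        exact Finset.sum_le_sum fun x _ => hP.one_le_green_self (Finset.singleton_nonempty r) x

end Minor

/-! ### The expected cost of Wilson's algorithm -/

section ExpectedCost

variable {n : ℕ} {G : SimpleGraph (Fin n)} (A : AdjLists G) {w : CostModel}
  (hdraw : 1 ≤ w.draw) {S : Fin n → Bool} {β : Type} {k : Parents n → Prog β}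

open Prog

section Walk

include hdraw

theorem walk_bind_eq (u : Fin n) (next : Parents n) :
    walk w A S u next >>= k = (do
      runTimed w (tick)
      if S u then
        k next
      else
        let x ← randomNeighbor w A u
        walk w A S x (Function.update next u (some x)) >>= k) := by
  rw [walk_eq A S hdraw, bind_assoc]
  congr 1
  funext _
  split_ifs
  · exact pure_bind _ _
  · exact bind_assoc _ _ _

theorem expectedCost_walk_bind_of_mem {u : Fin n} (hu : S u = true) (next : Parents n) :
    expectedCost (walk w A S u next >>= k) = w.basic + expectedCost (k next) := by
  rw [walk_bind_eq A hdraw, expectedCost_runTimed_bind, if_pos hu, tick_time, mul_one]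

variable [DecidableRel G.Adj] (hd : ∀ u, G.degree u ≠ 0)

include hd

theorem expectedCost_walk_bind_of_notMem {u : Fin n} (hu : S u = false) (next : Parents n) :
    expectedCost (walk w A S u next >>= k) = w.basic + (w.draw +
      ∑ x, ENNReal.ofReal (transitionMatrix G u x) *
        expectedCost (walk w A S x (Function.update next u (some x)) >>= k)) := by
  rw [walk_bind_eq A hdraw, expectedCost_runTimed_bind, if_neg (by simp [hu]),
    expectedCost_randomNeighbor_bind A hd, tick_time, mul_one]

theorem sum_range_walk_bind_of_notMem_le {u : Fin n} (hu : S u = false) (next : Parents n) (N : ℕ) :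
    ∑ t ∈ Finset.range N, (walk w A S u next >>= k) t none ≤ w.basic + (w.draw +
      ∑ x, ENNReal.ofReal (transitionMatrix G u x) * ∑ t ∈ Finset.range (N - w.basic - w.draw),
        (walk w A S x (Function.update next u (some x)) >>= k) t none) := by
  obtain ⟨μ, hμ, hdelayed⟩ := randomNeighbor_eq_uniform (w := w) A hd u
  rw [walk_bind_eq A hdraw, runTimed_eq_delayed, if_neg (by simp [hu]), hdelayed]
  refine (sum_range_delayed_bind_le _ _ _ _).trans ?_
  rw [tsum_fintype, Fintype.sum_unique, PMF.pure_apply, if_pos rfl, one_mul, tick_time, mul_one]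
  gcongr
  refine (sum_range_delayed_bind_le _ _ _ _).trans_eq ?_
  simp only [tsum_fintype, hμ]

variable {X : Type*} {pos : X → Fin n} {next : X → Parents n} {Φ : X → ℝ}
  (hΦ : ∀ s, 0 ≤ Φ s)

include hΦ

theorem expectedCost_walk_bind_le
    (hmem : ∀ s, S (pos s) = true → w.basic + expectedCost (k (next s)) ≤ ENNReal.ofReal (Φ s))
    (hstep : ∀ s, S (pos s) = false → ∃ σ : Fin n → X,
      (∀ y, G.Adj (pos s) y → pos (σ y) = y ∧
        next (σ y) = Function.update (next s) (pos s) (some y)) ∧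
      w.basic + w.draw + ∑ y, transitionMatrix G (pos s) y * Φ (σ y) ≤ Φ s) (s : X) :
    expectedCost (walk w A S (pos s) (next s) >>= k) ≤ ENNReal.ofReal (Φ s) := by
  rw [expectedCost, ENNReal.tsum_eq_iSup_nat]
  refine iSup_le fun N => ?_
  induction N using Nat.strong_induction_on generalizing s with
  | _ N ih =>
    cases hu : S (pos s) with
    | true =>
      refine (ENNReal.sum_le_tsum _).trans ?_
      exact (expectedCost_walk_bind_of_mem A hdraw hu _).trans_le (hmem s hu)
    | false =>
      obtain rfl | hN := Nat.eq_zero_or_pos N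
      · simp
      obtain ⟨σ, hσ, hle⟩ := hstep s hu
      have hterm : ∀ y, 0 ≤ transitionMatrix G (pos s) y * Φ (σ y) := fun y =>
        mul_nonneg (transitionMatrix_nonneg hd _ y) (hΦ _)
      calc ∑ t ∈ Finset.range N, (walk w A S (pos s) (next s) >>= k) t none
          ≤ w.basic + (w.draw + ∑ y, ENNReal.ofReal (transitionMatrix G (pos s) y * Φ (σ y))) := by
            refine (sum_range_walk_bind_of_notMem_le A hdraw hd hu _ N).trans ?_
            gcongr with y
            rw [ENNReal.ofReal_mul (transitionMatrix_nonneg hd _ y)]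
            by_cases hy : G.Adj (pos s) y
            · have hih := ih (N - w.basic - w.draw) (by omega) (σ y)
              rw [(hσ y hy).1, (hσ y hy).2] at hih
              gcongr
            · simp [transitionMatrix_apply hd, hy]
        _ = ENNReal.ofReal (w.basic + w.draw + ∑ y, transitionMatrix G (pos s) y * Φ (σ y)) := by
            rw [← ENNReal.ofReal_sum_of_nonneg fun y _ => hterm y, add_assoc,
              ENNReal.ofReal_add (by positivity)
                (add_nonneg (by positivity) (Finset.sum_nonneg fun y _ => hterm y)),
              ENNReal.ofReal_add (by positivity) (Finset.sum_nonneg fun y _ => hterm y),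
              ENNReal.ofReal_natCast, ENNReal.ofReal_natCast]
        _ ≤ ENNReal.ofReal (Φ s) := ENNReal.ofReal_le_ofReal hle

theorem expectedCost_walk_bind_eq (hP : IsIrreducibleStochastic (transitionMatrix G))
    (hS : (treeSet S).Nonempty) [Finite X]
    (hmem : ∀ s, S (pos s) = true → w.basic + expectedCost (k (next s)) = ENNReal.ofReal (Φ s))
    (hstep : ∀ s, S (pos s) = false → ∃ σ : Fin n → X,
      (∀ y, G.Adj (pos s) y → pos (σ y) = y ∧
        next (σ y) = Function.update (next s) (pos s) (some y)) ∧
      w.basic + w.draw + ∑ y, transitionMatrix G (pos s) y * Φ (σ y) = Φ s) (s : X) :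
    expectedCost (walk w A S (pos s) (next s) >>= k) = ENNReal.ofReal (Φ s) := by
  have hfinite : ∀ s, expectedCost (walk w A S (pos s) (next s) >>= k) ≠ ∞ := fun s =>
    ne_top_of_le_ne_top ENNReal.ofReal_ne_top <|
      expectedCost_walk_bind_le A hdraw hd hΦ (fun s hs => (hmem s hs).le)
        (fun s hs => (hstep s hs).imp fun _ hσ => ⟨hσ.1, hσ.2.le⟩) s
  rw [← ENNReal.ofReal_toReal (hfinite s)]
  congr 1
  refine hP.eq_of_sub_eq_of_lift hS pos
    (f := fun s => (expectedCost (walk w A S (pos s) (next s) >>= k)).toReal)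
    (fun s hs => ?_) (fun s hs => ?_) s
  · have hu := mem_treeSet.1 hs
    rw [expectedCost_walk_bind_of_mem A hdraw hu, hmem s hu, ENNReal.toReal_ofReal (hΦ s)]
  · have hu := notMem_treeSet.1 hs
    obtain ⟨σ, hσ, hΦs⟩ := hstep s hu
    refine ⟨σ, fun y hy => (hσ y ((transitionMatrix_pos_iff hd).1 hy)).1, ?_⟩
    have first_step : expectedCost (walk w A S (pos s) (next s) >>= k) = w.basic + (w.draw +
        ∑ y, ENNReal.ofReal (transitionMatrix G (pos s) y) *
          expectedCost (walk w A S (pos (σ y)) (next (σ y)) >>= k)) := by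
      rw [expectedCost_walk_bind_of_notMem A hdraw hd hu]
      congr 2
      refine Finset.sum_congr rfl fun y _ => ?_
      by_cases hy : G.Adj (pos s) y
      · rw [(hσ y hy).1, (hσ y hy).2]
      · simp [transitionMatrix_apply hd, hy]
    have hterm : ∀ y ∈ Finset.univ, ENNReal.ofReal (transitionMatrix G (pos s) y) *
        expectedCost (walk w A S (pos (σ y)) (next (σ y)) >>= k) ≠ ∞ := fun y _ =>
      ENNReal.mul_ne_top ENNReal.ofReal_ne_top (hfinite _)
    have hsum := ENNReal.sum_ne_top.2 hterm
    rw [first_step, ENNReal.toReal_add (by simp) (ENNReal.add_ne_top.2 ⟨by simp, hsum⟩),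
      ENNReal.toReal_add (by simp) hsum, ENNReal.toReal_sum hterm]
    simp only [ENNReal.toReal_mul, ENNReal.toReal_natCast,
      ENNReal.toReal_ofReal (transitionMatrix_nonneg hd _ _)]
    linarith

end Walk

section Wilson

variable [DecidableRel G.Adj] (hd : ∀ u, G.degree u ≠ 0)
  (hP : IsIrreducibleStochastic (transitionMatrix G))

include hdraw hd hP

theorem expectedCost_walk_bind (hS : (treeSet S).Nonempty) (v : Fin n) (next : Parents n) {c : ℝ}
    (hc : 0 ≤ c) (hk : ∀ (next' : Parents n) (β : List (Fin n)) (u : Fin n),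
      LoopErased G S v next' β u → S u = true → w.basic + expectedCost (k next') =
        ENNReal.ofReal (c + (w.basic + w.draw) *
          greenTrace (transitionMatrix G) (treeSet (addList S β)))) :
    expectedCost (walk w A S v next >>= k) = ENNReal.ofReal
      (c + (w.basic + w.draw) * greenTrace (transitionMatrix G) (treeSet S)) := by
  rw [← hP.remainingSteps_nil hS v]
  refine expectedCost_walk_bind_eq A hdraw hd (X := WalkState G S v) (pos := WalkState.pos)
    (next := WalkState.next)
    (Φ := fun s => c + (w.basic + w.draw) *
      remainingSteps (transitionMatrix G) (treeSet S) s.path s.pos)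
    (fun s => by have := hP.remainingSteps_nonneg hS s.path s.pos; positivity) hP hS
    (fun s hs => ?_) (fun s hs => ?_) ⟨v, next, [], LoopErased.nil S v next⟩
  · rw [hk _ _ _ s.loopErased hs, hP.remainingSteps_of_mem
      (fun a ha => notMem_treeSet.2 (s.loopErased.notMem a ha)) (mem_treeSet.2 hs), treeSet_addList]
  · obtain ⟨σ, hσ⟩ := s.exists_step hs
    refine ⟨σ, fun y hy => ⟨(hσ y hy).1, (hσ y hy).2.1⟩, ?_⟩
    have loop_erasure : ∀ y, transitionMatrix G s.pos y *
        remainingSteps (transitionMatrix G) (treeSet S) (σ y).path (σ y).pos =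
        transitionMatrix G s.pos y *
          remainingSteps (transitionMatrix G) (treeSet S) (s.pos :: s.path) y := by
      intro y
      by_cases hy : G.Adj s.pos y
      · obtain ⟨hpos, -, hpath | ⟨pre, hpath⟩⟩ := hσ y hy
        · rw [hpos, hpath]
        · have hyS : y ∉ treeSet S := by
            have path_notMem : ∀ a ∈ s.pos :: s.path, S a = false :=
              List.forall_mem_cons.2 ⟨hs, s.loopErased.notMem⟩
            exact notMem_treeSet.2 (path_notMem y (by simp [hpath]))
          rw [hpos, hpath, hP.remainingSteps_append pre _ (hpath ▸ s.loopErased.nodup) hyS]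
      · simp [transitionMatrix_apply hd, hy]
    rw [hP.remainingSteps_step hS (notMem_treeSet.2 hs) s.loopErased.notMem_path]
    simp only [mul_add, Finset.sum_add_distrib, ← Finset.sum_mul, hP.sum_eq_one, one_mul,
      mul_left_comm _ (_ + _ : ℝ), ← Finset.mul_sum, loop_erasure]
    ring

theorem expectedCost_foldlM_wilsonStep {r : Fin n} (l : List (Fin n)) (hr : S r = true)
    (hl : ∀ v, S v = false → v ∈ l) (next : Parents n) :
    expectedCost (l.foldlM (wilsonStep A w) (S, next)) =
      ENNReal.ofReal (w.basic * (2 * l.length + (treeSet S)ᶜ.card) +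
        (w.basic + w.draw) * greenTrace (transitionMatrix G) (treeSet S)) := by
  induction l generalizing S next with
  | nil =>
    have compl_empty : (treeSet S)ᶜ = ∅ := by
      simpa [Finset.eq_empty_iff_forall_notMem, mem_treeSet] using hl
    rw [List.foldlM_nil, expectedCost_pure, greenTrace, compl_empty]
    simp
  | cons v l ih =>
    have hS : (treeSet S).Nonempty := ⟨r, mem_treeSet.2 hr⟩
    have unfold_step : (v :: l).foldlM (wilsonStep A w) (S, next) =
        walk w A S v next >>= fun next' => runTimed w (addPath next' n v S) >>= fun S' =>
          l.foldlM (wilsonStep A w) (S', next') := by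
      simp only [List.foldlM_cons, wilsonStep, bind_assoc, pure_bind]
    rw [unfold_step]
    refine expectedCost_walk_bind A hdraw hd hP hS v next (by positivity) fun next' β u h hu => ?_
    have hnonneg := hP.greenTrace_nonneg (B := treeSet (addList S β))
      ⟨r, mem_treeSet.2 (by simp [addList, hr])⟩
    rw [expectedCost_runTimed_bind, h.addPath_eq hu, ih (by simp [addList, hr])
      (h.mem_of_addList_eq_false hu hl), h.card_compl_treeSet,
      ← ENNReal.ofReal_natCast, ← ENNReal.ofReal_natCast,
      ← ENNReal.ofReal_add (by positivity) (by positivity),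
      ← ENNReal.ofReal_add (by positivity) (by positivity)]
    congr 1
    push_cast [List.length_cons]
    ring

theorem expectedCost_wilson (r : Fin n) :
    expectedCost (wilson w A r) = ENNReal.ofReal (w.basic * (5 * n - 1) +
      (w.basic + w.draw) * (laplacianMinor G r)⁻¹.trace) := by
  have treeSet_root : treeSet (Function.update (fun _ => false) r true) = {r} := by
    ext x
    by_cases hx : x = r <;> simp [mem_treeSet, hx]
  have hnonneg := hP.greenTrace_nonneg (Finset.singleton_nonempty r)
  rw [wilson_eq, expectedCost_runTimed_bind,
    expectedCost_bind (isLimitInvariant_foldlM (isLimitInvariant_wilsonStep A hdraw) _ _),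
    expectedCost_foldlM_wilsonStep A hdraw hd hP (r := r) _ (by simp) (by simp), treeSet_root,
    trace_inv_laplacianMinor hP]
  simp only [expectedCost_pure, mul_zero, tsum_zero, add_zero, tick_time]
  rw [← ENNReal.ofReal_natCast, ← ENNReal.ofReal_add (by positivity) (by positivity),
    Finset.card_compl, Finset.card_singleton, Fintype.card_fin, List.length_finRange,
    Nat.cast_pred (Fin.pos r)]
  congr 1
  push_cast
  ring

end Wilson

end ExpectedCost

/-! ### Wilson's algorithm returns a spanning tree -/

section SpanningTree

variable {n : ℕ} {G : SimpleGraph (Fin n)} {r : Fin n} {S : Fin n → Bool} {next next' : Parents n}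

open Prog

/-- The pointers `next` make the set of vertices that is recorded by the flags `S` the vertex set of
a tree with root `r` in `G`. -/
structure IsPartialTree (G : SimpleGraph (Fin n)) (r : Fin n) (S : Fin n → Bool)
    (next : Parents n) : Prop where
  mem_root : S r = true
  root_eq_none : next r = none
  parent : ∀ v, S v = true → v ≠ r → ∃ p, next v = some p ∧ S p = true ∧ G.Adj v p
  reaches : ∀ v, S v = true → ∃ k, ancestor next k v = some r

namespace IsPartialTree

theorem root (r : Fin n) :
    IsPartialTree G r (Function.update (fun _ => false) r true) fun _ => none := by
  have eq_root : ∀ v, Function.update (fun _ => false) r true v = true → v = r := fun v hv => by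
    by_contra hne
    simp [Function.update_of_ne hne] at hv
  exact ⟨by simp, rfl, fun v hv hne => absurd (eq_root v hv) hne,
    fun v hv => ⟨0, by rw [eq_root v hv, ancestor_zero]⟩⟩

theorem isSpanningTree (h : IsPartialTree G r S next) (hS : ∀ v, S v = true) :
    IsSpanningTree G r next :=
  ⟨h.root_eq_none, fun v hv => (h.parent v (hS v) hv).imp fun _ hp => ⟨hp.1, hp.2.2⟩,
    fun v => h.reaches v (hS v)⟩

theorem congr (h : IsPartialTree G r S next) (heq : ∀ a, S a = true → next' a = next a) :
    IsPartialTree G r S next' := by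
  refine ⟨h.mem_root, (heq r h.mem_root).trans h.root_eq_none, fun v hv hvr => ?_, fun v hv => ?_⟩
  · rw [heq v hv]
    exact h.parent v hv hvr
  · obtain ⟨k, hk⟩ := h.reaches v hv
    refine ⟨k, ?_⟩
    induction k generalizing v with
    | zero => exact hk
    | succ k ih =>
      rw [ancestor_succ_eq_bind] at hk ⊢
      obtain rfl | hvr := eq_or_ne v r
      · simp [h.root_eq_none] at hk
      · obtain ⟨p, hp, hpS, -⟩ := h.parent v hv hvr
        rw [hp, Option.bind_some] at hk
        rw [heq v hv, hp, Option.bind_some]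
        exact ih p hpS hk

theorem update (h : IsPartialTree G r S next) {u b : Fin n} (hu : S u = true)
    (hb : next b = some u) (hadj : G.Adj b u) :
    IsPartialTree G r (Function.update S b true) next := by
  have mono : ∀ v, S v = true → Function.update S b true v = true := fun v hv => by
    rw [Function.update_apply, hv, ite_self]
  refine ⟨mono r h.mem_root, h.root_eq_none, fun v hv hvr => ?_, fun v hv => ?_⟩ <;>
    obtain rfl | hvb := eq_or_ne v b
  · exact ⟨u, hb, mono u hu, hadj⟩
  · rw [Function.update_of_ne hvb] at hv
    exact (h.parent v hv hvr).imp fun p hp => ⟨hp.1, mono p hp.2.1, hp.2.2⟩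
  · obtain ⟨k, hk⟩ := h.reaches u hu
    exact ⟨k + 1, by rw [ancestor_succ_eq_bind, hb, Option.bind_some, hk]⟩
  · rw [Function.update_of_ne hvb] at hv
    exact h.reaches v hv

theorem addList (β : List (Fin n)) (h : IsPartialTree G r S next) {u : Fin n} (hu : S u = true)
    (hchain : (u :: β).IsChain fun a b => next b = some a ∧ G.Adj b a) :
    IsPartialTree G r (addList S β) next := by
  induction β generalizing S u with
  | nil => rwa [addList_nil]
  | cons b β ih =>
    rw [List.isChain_cons_cons] at hchain
    rw [← addList_update]
    exact ih (h.update hu hchain.1.1 hchain.1.2) (Function.update_self b true S) hchain.2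

end IsPartialTree

variable [DecidableRel G.Adj] (A : AdjLists G) {w : CostModel} (hd : ∀ u, G.degree u ≠ 0)
include hd

theorem ensures_walkRounds {v u : Fin n} {β : List (Fin n)} (h : LoopErased G S v next β u)
    (f : ℕ) :
    (walkRounds w A S f u next).Ensures fun next' => (∀ a, S a = true → next' a = next a) ∧
      ∃ u β, S u = true ∧ LoopErased G S v next' β u := by
  induction f generalizing u next β with
  | zero =>
    intro t a s hne
    simp [walkRounds] at hne
  | succ f ih =>
    refine (ensures_runTimed (Q := fun _ => True) trivial).bind fun _ _ => ?_
    split_ifs with hu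
    · exact ensures_pure ⟨fun _ _ => rfl, u, β, hu, h⟩
    · refine (ensures_randomNeighbor A hd u).bind fun x hx => ?_
      obtain ⟨β', h', -⟩ := h.step (by simpa using hu) hx
      intro t next' s hne
      obtain ⟨heq, hend⟩ := ih h' t next' s hne
      refine ⟨fun a ha => (heq a ha).trans (Function.update_of_ne ?_ _ _), hend⟩
      rintro rfl
      exact hu ha

theorem ensures_walk (S : Fin n → Bool) (v : Fin n) (next : Parents n) :
    (walk w A S v next).Ensures fun next' => (∀ a, S a = true → next' a = next a) ∧
      ∃ u β, S u = true ∧ LoopErased G S v next' β u :=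
  fun t => ensures_walkRounds A hd (LoopErased.nil S v next) (t + 2) t

theorem ensures_foldlM_wilsonStep (l : List (Fin n)) (h : IsPartialTree G r S next)
    (hl : ∀ v, S v = false → v ∈ l) :
    (l.foldlM (wilsonStep A w) (S, next)).Ensures fun s => IsSpanningTree G r s.2 := by
  induction l generalizing S next with
  | nil => exact ensures_pure (h.isSpanningTree (by simpa using hl))
  | cons v l ih =>
    rw [List.foldlM_cons]
    refine Ensures.bind (Q := fun s => IsPartialTree G r s.1 s.2 ∧ ∀ x, s.1 x = false → x ∈ l) ?_
      fun s hs => ih hs.1 hs.2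
    refine (ensures_walk A hd S v next).bind ?_
    rintro next' ⟨heq, u, β, hu, hβ⟩
    refine (ensures_runTimed (Q := fun S' => S' = addList S β) (by rw [hβ.addPath_eq hu])).bind ?_
    rintro _ rfl
    refine ensures_pure ⟨(h.congr heq).addList β hu hβ.chain, ?_⟩
    exact hβ.mem_of_addList_eq_false hu hl

theorem ensures_wilson (r : Fin n) : (wilson w A r).Ensures (IsSpanningTree G r) :=
  (ensures_runTimed (Q := fun _ => True) trivial).bind fun _ _ =>
    (ensures_foldlM_wilsonStep A hd _ (IsPartialTree.root r) (by simp)).bind fun _ => ensures_pure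

end SpanningTree

/-! ### The running time of the whole algorithm -/

section Total

variable {n : ℕ} {G : SimpleGraph (Fin n)} (A : AdjLists G)

open Prog

section SamplingLoop

variable {r : Fin n} (D : Prep n)

theorem isLimitInvariant_samplingLoop (ω : ℕ) (s : ℤ × (ℕ → ℤ)) :
    (samplingLoop A r D ω s).IsLimitInvariant := by
  induction ω generalizing s with
  | zero => exact isLimitInvariant_pure s
  | succ ω ih =>
    exact (isLimitInvariant_runTimed _ _).bind fun _ =>
      (isLimitInvariant_wilson A le_rfl r).bind fun _ =>
        (isLimitInvariant_runTimed _ _).bind ih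

theorem expectedCost_samplingLoop_le_mul [DecidableRel G.Adj]
    (hd : ∀ u, G.degree u ≠ 0) {K : ℝ≥0∞}
    (hK : ∀ τ, IsSpanningTree G r τ → ∀ s,
      ((processSample A r D D.mode τ s).time : ℝ≥0∞) ≤ K) (ω : ℕ) (s : ℤ × (ℕ → ℤ)) :
    expectedCost (samplingLoop A r D ω s) ≤
      ω * (1 + (expectedCost (wilson timeCost A r) + K)) := by
  induction ω generalizing s with
  | zero => exact (expectedCost_pure s).trans_le zero_le
  | succ ω ih =>
    have rest : ∀ τ, IsSpanningTree G r τ → expectedCost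
        (runTimed timeCost (processSample A r D D.mode τ s) >>= samplingLoop A r D ω) ≤
          K + ω * (1 + (expectedCost (wilson timeCost A r) + K)) := fun τ hτ => by
      rw [expectedCost_runTimed_bind]
      refine add_le_add ?_ (ih _)
      simpa [timeCost] using hK τ hτ s
    calc expectedCost (samplingLoop A r D (ω + 1) s)
        = 1 + expectedCost (wilson timeCost A r >>= fun τ =>
            runTimed timeCost (processSample A r D D.mode τ s) >>= samplingLoop A r D ω) := by
          rw [samplingLoop, expectedCost_runTimed_bind]
          simp [timeCost]
      _ ≤ 1 + (expectedCost (wilson timeCost A r) +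
            (K + ω * (1 + (expectedCost (wilson timeCost A r) + K)))) := by
          gcongr
          exact expectedCost_bind_le (isLimitInvariant_wilson A le_rfl r)
            (ensures_wilson A hd r) rest
      _ = (ω + 1 : ℕ) * (1 + (expectedCost (wilson timeCost A r) + K)) := by
          push_cast
          ring

end SamplingLoop

variable [DecidableRel G.Adj] (hn : 2 ≤ n) (hG : G.Connected) (r : Fin n)

include hn hG

theorem one_le_trace : 1 ≤ (laplacianMinor G r)⁻¹.trace := by
  have := card_sub_one_le_trace (isIrreducibleStochastic_transitionMatrix hn hG) r
  have : (2 : ℝ) ≤ n := by exact_mod_cast hn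
  linarith

theorem expectedCost_wilson_timeCost_le : expectedCost (wilson timeCost A r) ≤
    ENNReal.ofReal (11 * (laplacianMinor G r)⁻¹.trace) := by
  have hP := isIrreducibleStochastic_transitionMatrix hn hG
  rw [expectedCost_wilson A le_rfl (degree_ne_zero hn hG) hP]
  refine ENNReal.ofReal_le_ofReal ?_
  simp only [timeCost, Nat.cast_one]
  linarith [card_sub_one_le_trace hP r, one_le_trace hn hG r]

theorem expectedCost_samplingLoop_le (ω : ℕ) (s : ℤ × (ℕ → ℤ)) :
    expectedCost (samplingLoop A r (preprocess A r).val ω s) ≤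
      ENNReal.ofReal (42 * (ω * ((laplacianMinor G r)⁻¹.trace +
        n * min (G.diam : ℝ) (Real.log n)))) := by
  have one_le := one_le_trace hn hG r
  set T := (laplacianMinor G r)⁻¹.trace
  set M := (n : ℝ) * min (G.diam : ℝ) (Real.log n)
  calc _ ≤ ω * (1 + (expectedCost (wilson timeCost A r) + ENNReal.ofReal (42 * M))) := by
        refine expectedCost_samplingLoop_le_mul A _ (degree_ne_zero hn hG) (fun τ hτ s => ?_) ω s
        rw [← ENNReal.ofReal_natCast]
        exact ENNReal.ofReal_le_ofReal (processSample_time_le hG A hτ.1 s hn)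
    _ ≤ ω * (ENNReal.ofReal 1 + (ENNReal.ofReal (11 * T) + ENNReal.ofReal (42 * M))) := by
        rw [ENNReal.ofReal_one]
        gcongr
        exact expectedCost_wilson_timeCost_le A hn hG r
    _ = ENNReal.ofReal (ω * (1 + (11 * T + 42 * M))) := by
        rw [ENNReal.ofReal_mul ω.cast_nonneg, ENNReal.ofReal_natCast,
          ENNReal.ofReal_add (by positivity) (by positivity),
          ENNReal.ofReal_add (by positivity) (by positivity)]
    _ ≤ ENNReal.ofReal (ω * (42 * (T + M))) := by
        gcongr
        linarith
    _ = ENNReal.ofReal (42 * (ω * (T + M))) := by rw [mul_left_comm]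

theorem expectedCost_ttf_le (ω : ℕ) :
    expectedCost (ttf A r ω) ≤
      ENNReal.ofReal (42 * (G.edgeFinset.card + ω * ((laplacianMinor G r)⁻¹.trace +
        n * min (G.diam : ℝ) (Real.log n)))) := by
  have : Nontrivial (Fin n) := Fin.nontrivial_iff_two_le.2 hn
  have one_le := one_le_trace hn hG r
  have one_le_card : (1 : ℝ) ≤ G.edgeFinset.card := by
    have := card_le_two_mul_card_edgeFinset hG
    rw [Fintype.card_fin] at this
    exact_mod_cast (show 1 ≤ G.edgeFinset.card by omega)
  have preprocess_le : ((preprocess A r).time : ℝ) ≤ 30 * G.edgeFinset.card := by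
    exact_mod_cast preprocess_time_le hn hG A r
  set T := (laplacianMinor G r)⁻¹.trace
  set M := (n : ℝ) * min (G.diam : ℝ) (Real.log n)
  have last : ∀ s : ℤ × (ℕ → ℤ), expectedCost (runTimed timeCost tick >>= fun _ =>
      (pure ((s.1 : ℚ) / (((preprocess A r).val.twoM : ℚ) * ω)) : Prog ℚ)) ≤ 1 := fun s => by
    rw [expectedCost_runTimed_bind, expectedCost_pure]
    simp [timeCost]
  calc expectedCost (ttf A r ω)
      ≤ (preprocess A r).time + (ENNReal.ofReal (42 * (ω * (T + M))) + 1) := by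
        rw [ttf, expectedCost_runTimed_bind]
        simp only [timeCost, one_mul]
        gcongr
        refine (expectedCost_bind_le (isLimitInvariant_samplingLoop A _ _ _)
          (Q := fun _ => True) (fun _ _ _ _ => trivial) fun s _ => last s).trans ?_
        gcongr
        exact expectedCost_samplingLoop_le A hn hG r ω _
    _ = ENNReal.ofReal ((preprocess A r).time + (42 * (ω * (T + M)) + 1)) := by
        rw [ENNReal.ofReal_add (by positivity) (by positivity),
          ENNReal.ofReal_add (by positivity) (by positivity), ENNReal.ofReal_natCast,
          ENNReal.ofReal_one]
    _ ≤ ENNReal.ofReal (42 * (G.edgeFinset.card + ω * (T + M))) :=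
        ENNReal.ofReal_le_ofReal (by linarith)

end Total

end KemenyTTF

theorem mainTheorem10 :
    ∃ C : ℝ, 0 < C ∧
      ∀ (n : ℕ), 2 ≤ n →
      ∀ (G : SimpleGraph (Fin n)) [DecidableRel G.Adj], G.Connected →
      ∀ (A : KemenyTTF.AdjLists G) (r : Fin n),
        -- `I - P_r` is invertible
        IsUnit (KemenyTTF.laplacianMinor G r) ∧
        -- Wilson's algorithm: expected number of random-walk steps, and expected running time
        KemenyTTF.expectedCost (KemenyTTF.wilson KemenyTTF.walkCost A r) =
          ENNReal.ofReal (KemenyTTF.laplacianMinor G r)⁻¹.trace ∧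
        KemenyTTF.expectedCost (KemenyTTF.wilson KemenyTTF.timeCost A r) ≤
          ENNReal.ofReal (C * (KemenyTTF.laplacianMinor G r)⁻¹.trace) ∧
        -- processing one sampled tree, with either implementation of `vol_sum`
        (∀ (τ : KemenyTTF.Parents n), KemenyTTF.IsSpanningTree G r τ → ∀ s : ℤ × (ℕ → ℤ),
          ((KemenyTTF.processSample A r (KemenyTTF.preprocess A r).val .bit τ s).time : ℝ) ≤
            C * (n * Real.log n) ∧
          ((KemenyTTF.processSample A r (KemenyTTF.preprocess A r).val .path τ s).time : ℝ) ≤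
            C * (n * G.diam)) ∧
        -- preprocessing
        ((KemenyTTF.preprocess A r).time : ℝ) ≤ C * G.edgeFinset.card ∧
        -- the sampling loop, and the whole algorithm
        ∀ ω : ℕ,
          (∀ s : ℤ × (ℕ → ℤ),
            KemenyTTF.expectedCost
                (KemenyTTF.samplingLoop A r (KemenyTTF.preprocess A r).val ω s) ≤
              ENNReal.ofReal (C * (ω * ((KemenyTTF.laplacianMinor G r)⁻¹.trace +
                n * min (G.diam : ℝ) (Real.log n))))) ∧
          KemenyTTF.expectedCost (KemenyTTF.ttf A r ω) ≤
            ENNReal.ofReal (C * (G.edgeFinset.card +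
              ω * ((KemenyTTF.laplacianMinor G r)⁻¹.trace +
                n * min (G.diam : ℝ) (Real.log n)))) := by
  refine ⟨42, by norm_num, fun n hn G _ hG A r => ?_⟩
  have hP := KemenyTTF.isIrreducibleStochastic_transitionMatrix hn hG
  refine ⟨KemenyTTF.isUnit_laplacianMinor hP r, ?_, ?_, fun τ hτ s =>
    ⟨KemenyTTF.processSample_bit_time_le_log hG A hτ.1 s hn,
      KemenyTTF.processSample_path_time_le_diam hG A hτ.1 s hn⟩, ?_, fun ω =>
    ⟨KemenyTTF.expectedCost_samplingLoop_le A hn hG r ω,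
      KemenyTTF.expectedCost_ttf_le A hn hG r ω⟩⟩
  · rw [KemenyTTF.expectedCost_wilson A le_rfl (KemenyTTF.degree_ne_zero hn hG) hP]
    simp [KemenyTTF.walkCost]
  · refine (KemenyTTF.expectedCost_wilson_timeCost_le A hn hG r).trans ?_
    gcongr
    · exact zero_le_one.trans (KemenyTTF.one_le_trace hn hG r)
    · norm_num
  · calc ((KemenyTTF.preprocess A r).time : ℝ)
        ≤ 30 * G.edgeFinset.card := by exact_mod_cast KemenyTTF.preprocess_time_le hn hG A r
      _ ≤ 42 * G.edgeFinset.card := by gcongr; norm_num
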